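/- Let $d\in[0,\tfrac12)$ and let $\{\tau_k\}_{k\in\mathbb Z}$ be generated by the Long-Memory Stochastic Duration (LMSD) model with memory parameter $d$ under a probability measure $P^0$ (with expectation $E^0$), that is, $$\tau_k=e^{h_k}\epsilon_k,\qquad h_k=\sum_{j=0}^\infty b_j e_{k-j}\qquad(k\in\mathbb Z),$$ where, under $P^0$, the $\epsilon_k\ge 0$ are i.i.d. with all moments finite, the $e_k$ are i.i.d. Gaussian with mean zero, the sequence $\{e_k\}$ is independent of the sequence $\{\epsilon_k\}$, and the real coefficients $b_j$ satisfy, for some constant $C\neq0$, as $j\to\infty$, $$b_j\sim C j^{d-1}\ \text{ if } d\in(0,\tfrac12),\qquad b_j\sim C a^j\ \text{ for some real } a \text{ with } |a|<1\ \text{ if } d=0.$$ For $n\ge1$ let $$y_n=\frac{\sum_{k=1}^n\tau_k}{n^{1/2+d}}.$$ Then for every fixed integer $p\ge2$, $E^0\{|y_n-E^0(y_n)|^p\}$ is finite and bounded uniformly in $n\ge 1$: $\ \sup_{n\ge1}E^0|y_n-E^0(y_n)|^p<\infty$. -/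

import Mathlib

open MeasureTheory ProbabilityTheory Filter Topology
open scoped NNReal

/-- The moving-average coefficients of the log-volatility process with memory parameter `d`:
`b j ~ C * j ^ (d - 1)` if `0 < d`, and `b j ~ C * a ^ j` with `|a| < 1` if `d = 0`, as `j → ∞`,
where `C ≠ 0`. (For `a = 0` the second condition says that `b j` vanishes for all large `j`.) -/
def LMSDCoeff (d : ℝ) (b : ℕ → ℝ) : Prop :=
  (0 < d → ∃ C : ℝ, C ≠ 0 ∧
    Asymptotics.IsEquivalent atTop b (fun j : ℕ => C * (j : ℝ) ^ (d - 1))) ∧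
  (d = 0 → ∃ C a : ℝ, C ≠ 0 ∧ |a| < 1 ∧
    Asymptotics.IsEquivalent atTop b (fun j : ℕ => C * a ^ j))

/-- `τ` is a Long-Memory Stochastic Duration process under the probability measure `P`, with memory
parameter `d`: `τ k = exp (h k) * ε k` with `h k = ∑_{j ≥ 0} b j * e (k - j)`. -/
structure IsLMSD {Ω : Type*} [MeasurableSpace Ω] (P : Measure Ω) (d : ℝ) (b : ℕ → ℝ)
    (e ε h τ : ℤ → Ω → ℝ) : Prop where
  coeff : LMSDCoeff d b
  /-- the `e k` are i.i.d. centred Gaussian -/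
  measurable_e : ∀ k, Measurable (e k)
  gaussian_e : ∃ v : ℝ≥0, ∀ k, P.map (e k) = gaussianReal 0 v
  indep_e : iIndepFun e P
  /-- the `ε k` are i.i.d., nonnegative, with all moments finite -/
  measurable_ε : ∀ k, Measurable (ε k)
  nonneg_ε : ∀ k, ∀ᵐ ω ∂P, 0 ≤ ε k ω
  identDistrib_ε : ∀ k, IdentDistrib (ε k) (ε 0) P P
  indep_ε : iIndepFun ε P
  moments_ε : ∀ (k : ℤ) (q : ℕ), Integrable (fun ω => |ε k ω| ^ q) P
  /-- the whole sequence `e` is independent of the whole sequence `ε` -/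
  indep_e_ε : IndepFun (fun ω (k : ℤ) => e k ω) (fun ω (k : ℤ) => ε k ω) P
  /-- `h k` is the sum of the series `∑_{j ≥ 0} b j * e (k - j)`, i.e. the limit of its partial
  sums. For independent centred Gaussian terms, convergence in probability, almost sure convergence
  and convergence in mean square are equivalent, with the same limit almost surely. (The series need
  not converge absolutely, so an unconditional sum would be wrong here.) -/
  series_h : ∀ k : ℤ, TendstoInMeasure P
    (fun (N : ℕ) ω => ∑ j ∈ Finset.range N, b j * e (k - (j : ℤ)) ω) atTop (h k)
  duration_eq : ∀ k ω, τ k ω = Real.exp (h k ω) * ε k ω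

/-- The normalized partial sum `y_n = n ^ (-(1/2 + d)) * ∑_{k=1}^n τ k`. -/
noncomputable def normalizedSum {Ω : Type*} (d : ℝ) (τ : ℤ → Ω → ℝ) (n : ℕ) (ω : Ω) : ℝ :=
  (∑ k ∈ Finset.Icc 1 n, τ (k : ℤ) ω) / (n : ℝ) ^ (1 / 2 + d)

/-! Let `v` be the variance of the `e i`, `μ` the mean of `ε 0`, `Q = ∑ b j ^ 2` and `κ = exp (v Q /
2)`, the mean of `exp (h k)`. With `W k = exp (h k) / κ`, of mean one, `τ k / κ - μ = μ (W k - 1) +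
W k (ε k - μ)`. It is enough to bound the even moments of both sums over `k ≤ n`, in the `L^{2m}`
norm, by a multiple of `n ^ (1/2 + d)`.

Both are sums of martingale differences. The substitute for Burkholder's inequality is a two-point
estimate (`integral_add_pow_le`): if `E X ^ (2m-1) Y = 0`, then `‖X + Y‖² ≤ ‖X‖² + C ‖Y‖²` in
`L^{2m}`. It is iterated over the increments.

For the noise sum, the `ε k` are revealed one at a time given all of `e`. Each increment has bounded
norm, so the squared norm is `O(n)` (`integral_sum_weighted_pow_le`).

For the volatility sum, `h k` is first truncated to finitely many innovations, which are then
revealed one at a time. Normalized exponentials are martingales, and the increment due to `e i` has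
norm at most a constant times `u i = ∑_{k ≤ n} |b (k - i)|`, the terms with `i > k` being zero
(`exists_integral_sum_wickExp_sub_one_pow_le`). So everything rests on the deterministic bound `∑ u
i ^ 2 = O(n ^ (1 + 2d))` (`LMSDCoeff.exists_sum_sq_maCoeff_le`), where `d < 1/2` enters.

Fatou's lemma removes the truncation, and moments about a constant control moments about the mean.
-/

/-! ### Random variables with all moments -/

/-- `f` has finite moments of every order. -/
def HasMoments {Ω : Type*} [MeasurableSpace Ω] (f : Ω → ℝ) (P : Measure Ω) : Prop :=
  ∀ q : ℕ, MemLp f q P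

namespace HasMoments

variable {Ω : Type*} [MeasurableSpace Ω] {P : Measure Ω} {f g : Ω → ℝ}

theorem aestronglyMeasurable (hf : HasMoments f P) : AEStronglyMeasurable f P := (hf 0).1

theorem integrable (hf : HasMoments f P) : Integrable f P := by
  have := hf 1
  rw [Nat.cast_one] at this
  exact memLp_one_iff_integrable.1 this

theorem add (hf : HasMoments f P) (hg : HasMoments g P) : HasMoments (fun ω => f ω + g ω) P :=
  fun q => (hf q).add (hg q)

theorem mul (hf : HasMoments f P) (hg : HasMoments g P) : HasMoments (fun ω => f ω * g ω) P := by
  intro q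
  have : ENNReal.HolderTriple ((2 * q : ℕ) : ENNReal) ((2 * q : ℕ) : ENNReal) (q : ENNReal) := by
    constructor
    rw [Nat.cast_mul, ENNReal.mul_inv (by simp) (by simp), ← add_mul]
    simp [ENNReal.inv_two_add_inv_two]
  exact (hg (2 * q)).mul' (hf (2 * q))

theorem const [IsFiniteMeasure P] (c : ℝ) : HasMoments (fun _ => c) P := fun _ => memLp_const c

theorem pow [IsFiniteMeasure P] (hf : HasMoments f P) (n : ℕ) :
    HasMoments (fun ω => f ω ^ n) P := by
  induction n with
  | zero => simpa using const (P := P) 1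
  | succ n ih => simpa [pow_succ] using ih.mul hf

theorem const_mul [IsFiniteMeasure P] (hf : HasMoments f P) (c : ℝ) :
    HasMoments (fun ω => c * f ω) P := (const c).mul hf

theorem sub_const [IsFiniteMeasure P] (hf : HasMoments f P) (c : ℝ) :
    HasMoments (fun ω => f ω - c) P := by
  simpa [sub_eq_add_neg] using hf.add (const (-c))

theorem sum {ι : Type*} (s : Finset ι) {F : ι → Ω → ℝ} (hF : ∀ i ∈ s, HasMoments (F i) P) :
    HasMoments (fun ω => ∑ i ∈ s, F i ω) P :=
  fun q => memLp_finsetSum s fun i hi => hF i hi q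

theorem of_integrable_abs_pow (hm : AEStronglyMeasurable f P)
    (h : ∀ q : ℕ, Integrable (fun ω => |f ω| ^ q) P) : HasMoments f P := by
  intro q
  rcases Nat.eq_zero_or_pos q with rfl | hq
  · simpa using hm
  · rw [← integrable_norm_rpow_iff hm (by simpa using hq.ne') (by simp)]
    simpa using h q

end HasMoments

/-! ### A two-point smoothness inequality in `L^{2m}` -/

/-- In the binomial expansion the linear term is kept exactly, since its expectation will vanish.
Every later term is at most `x ^ (2k) y ^ 2` or `y ^ (2k+2)` in absolute value, according to which
of `|x|`, `|y|` is larger; the binomial coefficients sum to at most `2 ^ (2k+2) = 4 ^ (k+1)`. -/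
theorem add_pow_le_of_even (k : ℕ) (x y : ℝ) :
    (x + y) ^ (2 * (k + 1)) ≤ x ^ (2 * (k + 1)) + 2 * (k + 1) * (x ^ (2 * k + 1) * y) +
      4 ^ (k + 1) * (x ^ (2 * k) * y ^ 2 + y ^ (2 * (k + 1))) := by
  set T : ℝ := x ^ (2 * k) * y ^ 2 + y ^ (2 * (k + 1)) with hT
  have hT0 : 0 ≤ T := by
    have h1 : 0 ≤ x ^ (2 * k) := by rw [pow_mul]; positivity
    have h2 : 0 ≤ y ^ (2 * (k + 1)) := by rw [pow_mul]; positivity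
    positivity
  have key : ∀ j ∈ Finset.range (2 * k + 1),
      y ^ (j + 2) * x ^ (2 * k - j) * ((2 * k + 2).choose (j + 2) : ℝ) ≤
        T * ((2 * k + 2).choose (j + 2) : ℝ) := by
    intro j hj
    refine mul_le_mul_of_nonneg_right ?_ (by positivity)
    have hj' : j ≤ 2 * k := by simpa [Nat.lt_succ_iff] using hj
    refine (le_abs_self _).trans ?_
    rw [abs_mul, abs_pow, abs_pow]
    have hTa : T = |x| ^ (2 * k) * |y| ^ 2 + |y| ^ (2 * (k + 1)) := by
      rw [hT, (even_two_mul k).pow_abs, (even_two_mul (k + 1)).pow_abs, even_two.pow_abs]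
    rw [hTa]
    rcases le_total |x| |y| with h | h
    · calc |y| ^ (j + 2) * |x| ^ (2 * k - j) ≤ |y| ^ (j + 2) * |y| ^ (2 * k - j) := by gcongr
        _ = |y| ^ (2 * (k + 1)) := by rw [← pow_add]; congr 1; omega
        _ ≤ _ := by linarith [show 0 ≤ |x| ^ (2 * k) * |y| ^ 2 by positivity]
    · calc |y| ^ (j + 2) * |x| ^ (2 * k - j) = |y| ^ 2 * |y| ^ j * |x| ^ (2 * k - j) := by ring
        _ ≤ |y| ^ 2 * |x| ^ j * |x| ^ (2 * k - j) := by gcongr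
        _ = |x| ^ (2 * k) * |y| ^ 2 := by
          rw [mul_assoc, ← pow_add, show j + (2 * k - j) = 2 * k by omega]; ring
        _ ≤ _ := by linarith [show 0 ≤ |y| ^ (2 * (k + 1)) by positivity]
  have hchoose : ∑ j ∈ Finset.range (2 * k + 1), ((2 * k + 2).choose (j + 2) : ℝ) ≤
      4 ^ (k + 1) := by
    have h : ((∑ j ∈ Finset.range (2 * k + 2 + 1), (2 * k + 2).choose j : ℕ) : ℝ) =
        4 ^ (k + 1) := by
      rw [Nat.sum_range_choose]; push_cast
      rw [show 2 * k + 2 = 2 * (k + 1) by ring, pow_mul]; norm_num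
    rw [Finset.sum_range_succ', Finset.sum_range_succ'] at h
    push_cast at h
    have h0 : (0 : ℝ) ≤ ((2 * k + 2).choose (0 + 1) : ℝ) := by positivity
    have h1 : (0 : ℝ) ≤ ((2 * k + 2).choose 0 : ℝ) := by positivity
    simp only [add_assoc, one_add_one_eq_two] at h h0 h1 ⊢
    linarith
  have hexp : (x + y) ^ (2 * (k + 1)) =
      ∑ j ∈ Finset.range (2 * k + 1),
        y ^ (j + 2) * x ^ (2 * k - j) * ((2 * k + 2).choose (j + 2) : ℝ) +
      2 * (k + 1) * (x ^ (2 * k + 1) * y) + x ^ (2 * (k + 1)) := by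
    rw [add_comm x y, add_pow, show 2 * (k + 1) + 1 = 2 * k + 1 + 1 + 1 by ring,
      Finset.sum_range_succ', Finset.sum_range_succ', show 2 * (k + 1) = 2 * k + 2 by ring]
    simp only [add_assoc, one_add_one_eq_two, pow_zero, Nat.choose_zero_right,
      Nat.choose_one_right, zero_add, pow_one, Nat.add_sub_add_right, Nat.sub_zero]
    rw [show 2 * k + 2 - 1 = 2 * k + 1 by omega]
    push_cast
    ring
  have := Finset.sum_le_sum key
  rw [← Finset.mul_sum] at this
  have h2 := mul_le_mul_of_nonneg_left hchoose hT0
  rw [hexp]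
  linarith

theorem pow_mul_le_pow_add_pow {a b : ℝ} (ha : 0 ≤ a) (hb : 0 ≤ b) (k : ℕ) :
    a ^ k * b ≤ a ^ (k + 1) + b ^ (k + 1) := by
  have h1 : 0 ≤ a ^ (k + 1) := by positivity
  have h2 : 0 ≤ b ^ (k + 1) := by positivity
  rcases le_total a b with h | h
  · calc a ^ k * b ≤ b ^ k * b := by gcongr
      _ = b ^ (k + 1) := by ring
      _ ≤ _ := by linarith
  · calc a ^ k * b ≤ a ^ k * a := by gcongr
      _ = a ^ (k + 1) := by ring
      _ ≤ _ := by linarith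

theorem pow_succ_add_le_pow {V w : ℝ} (hV : 0 ≤ V) (hw : 0 ≤ w) (k : ℕ) :
    V ^ (k + 1) + 2 / 3 * (V ^ k * w) + 1 / 3 * w ^ (k + 1) ≤ (V + w) ^ (k + 1) := by
  have h1 : V ^ k ≤ (V + w) ^ k := by gcongr; linarith
  have h2 : w ^ k ≤ (V + w) ^ k := by gcongr; linarith
  have e : (V + w) ^ (k + 1) = V * (V + w) ^ k + w * (V + w) ^ k := by ring
  have h3 := mul_le_mul_of_nonneg_left h1 hV
  have h4 := mul_le_mul_of_nonneg_left h1 hw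
  have h5 := mul_le_mul_of_nonneg_left h2 hw
  rw [e, pow_succ, pow_succ]
  nlinarith

section

variable {Ω : Type*} [MeasurableSpace Ω] {P : Measure Ω} [IsProbabilityMeasure P] {X Y : Ω → ℝ}

theorem integral_add_pow_le_of_pos (k : ℕ) (hX : HasMoments X P) (hY : HasMoments Y P)
    (h0 : ∫ ω, X ω ^ (2 * k + 1) * Y ω ∂P = 0) {V v : ℝ} (hV : 0 < V) (hv : 0 < v)
    (hXV : ∫ ω, X ω ^ (2 * (k + 1)) ∂P ≤ V ^ (k + 1))
    (hYv : ∫ ω, Y ω ^ (2 * (k + 1)) ∂P ≤ v ^ (k + 1)) :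
    ∫ ω, (X ω + Y ω) ^ (2 * (k + 1)) ∂P ≤ (V + 3 * 4 ^ (k + 1) * v) ^ (k + 1) := by
  have i1 := (hX.pow (2 * (k + 1))).integrable
  have i2 := (hY.pow (2 * (k + 1))).integrable
  have i3 := ((hX.pow (2 * k + 1)).mul hY).integrable
  have i4 := ((hX.pow (2 * k)).mul (hY.pow 2)).integrable
  have i5 := ((hX.add hY).pow (2 * (k + 1))).integrable
  -- Young's inequality for `X² / V` and `Y² / v` replaces Hölder here, at the price of a factor 2.
  have hmix : ∫ ω, X ω ^ (2 * k) * Y ω ^ 2 ∂P ≤ 2 * (V ^ k * v) := by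
    have hpt : ∀ ω, X ω ^ (2 * k) * Y ω ^ 2 ≤
        V ^ k * v * ((V ^ (k + 1))⁻¹ * X ω ^ (2 * (k + 1)) +
          (v ^ (k + 1))⁻¹ * Y ω ^ (2 * (k + 1))) := by
      intro ω
      have := pow_mul_le_pow_add_pow (a := X ω ^ 2 / V) (b := Y ω ^ 2 / v) (by positivity)
        (by positivity) k
      have h2 := mul_le_mul_of_nonneg_left this (show 0 ≤ V ^ k * v by positivity)
      have e1 : V ^ k * v * ((X ω ^ 2 / V) ^ k * (Y ω ^ 2 / v)) = X ω ^ (2 * k) * Y ω ^ 2 := by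
        rw [div_pow, ← pow_mul]; field_simp
      have e2 : V ^ k * v * ((X ω ^ 2 / V) ^ (k + 1) + (Y ω ^ 2 / v) ^ (k + 1)) =
          V ^ k * v * ((V ^ (k + 1))⁻¹ * X ω ^ (2 * (k + 1)) +
            (v ^ (k + 1))⁻¹ * Y ω ^ (2 * (k + 1))) := by
        rw [div_pow, div_pow, ← pow_mul, ← pow_mul]; ring
      rwa [e1, e2] at h2
    have := integral_mono i4 (((i1.const_mul _).add (i2.const_mul _)).const_mul _) hpt
    refine this.trans ?_
    simp only [Pi.add_apply]
    rw [integral_const_mul, integral_add (i1.const_mul _) (i2.const_mul _), integral_const_mul,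
      integral_const_mul]
    have a1 : (V ^ (k + 1))⁻¹ * ∫ ω, X ω ^ (2 * (k + 1)) ∂P ≤ 1 := by
      rw [inv_mul_le_iff₀ (by positivity)]; simpa using hXV
    have a2 : (v ^ (k + 1))⁻¹ * ∫ ω, Y ω ^ (2 * (k + 1)) ∂P ≤ 1 := by
      rw [inv_mul_le_iff₀ (by positivity)]; simpa using hYv
    have : 0 ≤ V ^ k * v := by positivity
    nlinarith
  have i6 : Integrable (fun ω => X ω ^ (2 * (k + 1)) +
      2 * (k + 1) * (X ω ^ (2 * k + 1) * Y ω)) P := i1.add (i3.const_mul _)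
  have i7 : Integrable (fun ω => X ω ^ (2 * k) * Y ω ^ 2 + Y ω ^ (2 * (k + 1))) P := i4.add i2
  have hint := integral_mono i5 (i6.add (i7.const_mul (4 ^ (k + 1))))
    (fun ω => add_pow_le_of_even k (X ω) (Y ω))
  refine hint.trans ?_
  simp only [Pi.add_apply]
  rw [integral_add i6 (i7.const_mul _), integral_add i1 (i3.const_mul _), integral_const_mul,
    integral_const_mul, integral_add i4 i2, h0]
  -- With `w = 3 * 4 ^ (k+1) * v`, the fraction `2/3` absorbs the mixed term, with its factor 2, and
  -- `1/3` absorbs the pure power of `v`.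
  refine le_trans ?_ (pow_succ_add_le_pow hV.le (show 0 ≤ 3 * 4 ^ (k + 1) * v by positivity) k)
  have hc : (1 : ℝ) ≤ 4 ^ (k + 1) := one_le_pow₀ (by norm_num)
  have hlast : 3 * 4 ^ (k + 1) * v ^ (k + 1) ≤ (3 * 4 ^ (k + 1) * v) ^ (k + 1) := by
    rw [mul_pow (3 * 4 ^ (k + 1)) v]
    gcongr
    exact le_self_pow₀ (by linarith) (by omega)
  have := mul_le_mul_of_nonneg_left (add_le_add hmix hYv) (show (0 : ℝ) ≤ 4 ^ (k + 1) by positivity)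
  nlinarith

/-- Degenerate bounds must be allowed because the inductions start from an empty sum with `V = 0`;
they are reached by letting `V + δ` and `v + δ` decrease. -/
theorem integral_add_pow_le (k : ℕ) (hX : HasMoments X P) (hY : HasMoments Y P)
    (h0 : ∫ ω, X ω ^ (2 * k + 1) * Y ω ∂P = 0) {V v : ℝ} (hV : 0 ≤ V) (hv : 0 ≤ v)
    (hXV : ∫ ω, X ω ^ (2 * (k + 1)) ∂P ≤ V ^ (k + 1))
    (hYv : ∫ ω, Y ω ^ (2 * (k + 1)) ∂P ≤ v ^ (k + 1)) :
    ∫ ω, (X ω + Y ω) ^ (2 * (k + 1)) ∂P ≤ (V + 3 * 4 ^ (k + 1) * v) ^ (k + 1) := by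
  have hlim : Tendsto (fun δ : ℝ => ((V + δ) + 3 * 4 ^ (k + 1) * (v + δ)) ^ (k + 1)) (𝓝[>] 0)
      (𝓝 (((V + 0) + 3 * 4 ^ (k + 1) * (v + 0)) ^ (k + 1))) := by
    refine Tendsto.mono_left ?_ nhdsWithin_le_nhds
    exact Continuous.tendsto (by fun_prop) 0
  rw [add_zero, add_zero] at hlim
  refine ge_of_tendsto hlim ?_
  filter_upwards [self_mem_nhdsWithin] with δ hδ
  have hδ : 0 < δ := hδ
  refine integral_add_pow_le_of_pos k hX hY h0 (by linarith) (by linarith) (hXV.trans ?_)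
    (hYv.trans ?_)
  · gcongr; linarith
  · gcongr; linarith

end

/-! ### Moving-average coefficients -/

/-- The coefficient of the innovation `e i` in `h k`. -/
noncomputable def maCoeff (b : ℕ → ℝ) (k i : ℤ) : ℝ := if i ≤ k then b (k - i).toNat else 0

/-- Bernoulli's inequality for the concave power `α`, applied to `s / (s+1) = 1 - 1 / (s+1)`. It
makes the power sums below telescope. -/
theorem rpow_sub_one_le_sub {α s : ℝ} (h0 : 0 ≤ α) (h1 : α ≤ 1) (hs : 0 ≤ s) :
    α * (s + 1) ^ (α - 1) ≤ (s + 1) ^ α - s ^ α := by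
  have hs1 : 0 < s + 1 := by linarith
  have hb := rpow_one_add_le_one_add_mul_self (s := -(s + 1)⁻¹)
    (by rw [neg_le_neg_iff]; exact inv_le_one_of_one_le₀ (by linarith)) h0 h1
  have he : s = (s + 1) * (1 + -(s + 1)⁻¹) := by field_simp; ring
  have hnn : 0 ≤ 1 + -(s + 1)⁻¹ := by
    have : (s + 1)⁻¹ ≤ 1 := inv_le_one_of_one_le₀ (by linarith)
    linarith
  have h2 : s ^ α = (s + 1) ^ α * (1 + -(s + 1)⁻¹) ^ α := by
    conv_lhs => rw [he]
    rw [Real.mul_rpow hs1.le hnn]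
  have h3 : (s + 1) ^ (α - 1) = (s + 1) ^ α * (s + 1)⁻¹ := by
    rw [Real.rpow_sub_one hs1.ne', div_eq_mul_inv]
  have h4 := mul_le_mul_of_nonneg_left hb (Real.rpow_nonneg hs1.le α)
  rw [h2, h3]
  linarith

theorem sum_range_rpow_le {d : ℝ} (h0 : 0 < d) (h1 : d ≤ 1) (N : ℕ) :
    ∑ j ∈ Finset.range N, ((j : ℝ) + 1) ^ (d - 1) ≤ (N : ℝ) ^ d / d := by
  induction N with
  | zero => simp [Real.zero_rpow h0.ne']
  | succ N ih =>
    rw [Finset.sum_range_succ]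
    have := rpow_sub_one_le_sub h0.le h1 (Nat.cast_nonneg N)
    have h2 : ((N : ℝ) + 1) ^ (d - 1) ≤ (((N : ℝ) + 1) ^ d - (N : ℝ) ^ d) / d := by
      rw [le_div_iff₀ h0]; linarith
    push_cast
    rw [sub_div] at h2
    linarith

theorem rpow_neg_one_sub_le {α s : ℝ} (h0 : 0 < α) (h1 : α ≤ 1) (hs : 1 ≤ s) :
    s ^ (-α - 1) ≤ 2 / α * (s ^ (-α) - (s + 1) ^ (-α)) := by
  have hs0 : 0 < s := by linarith
  have hs1 : 0 < s + 1 := by linarith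
  have h := rpow_sub_one_le_sub h0.le h1 hs0.le
  have hx : 0 < s ^ α := by positivity
  have hy : 0 < (s + 1) ^ α := by positivity
  rw [Real.rpow_sub_one hs1.ne'] at h
  rw [Real.rpow_sub_one hs0.ne', Real.rpow_neg hs0.le, Real.rpow_neg hs1.le]
  have e : (s ^ α)⁻¹ - ((s + 1) ^ α)⁻¹ = (s ^ α)⁻¹ * ((s + 1) ^ α)⁻¹ * ((s + 1) ^ α - s ^ α) := by
    field_simp
  rw [e]
  calc (s ^ α)⁻¹ / s ≤ (s ^ α)⁻¹ * (2 / (s + 1)) := by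
        rw [div_eq_mul_inv]
        gcongr
        rw [inv_eq_one_div, div_le_div_iff₀ hs0 hs1]; linarith
    _ = 2 / α * ((s ^ α)⁻¹ * ((s + 1) ^ α)⁻¹ * (α * ((s + 1) ^ α / (s + 1)))) := by
        field_simp
    _ ≤ _ := by gcongr

theorem sum_rpow_tail_le {α : ℝ} (h0 : 0 < α) (h1 : α ≤ 1) {n : ℕ} (hn : 1 ≤ n) (T : Finset ℕ)
    (hT : ∀ s ∈ T, n ≤ s) : ∑ s ∈ T, (s : ℝ) ^ (-α - 1) ≤ 2 / α * (n : ℝ) ^ (-α) := by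
  have hIco : ∀ N, n ≤ N → ∑ s ∈ Finset.Ico n N, (s : ℝ) ^ (-α - 1) ≤
      2 / α * ((n : ℝ) ^ (-α) - (N : ℝ) ^ (-α)) := by
    intro N hN
    induction N, hN using Nat.le_induction with
    | base => simp
    | succ N hN ih =>
      rw [Finset.sum_Ico_succ_top hN]
      have := rpow_neg_one_sub_le h0 h1 (s := N) (by exact_mod_cast hn.trans hN)
      push_cast
      linarith
  have hsub : T ⊆ Finset.Ico n (n + T.sup id + 1) := by
    intro s hs
    have : s ≤ T.sup id := Finset.le_sup (f := id) hs
    exact Finset.mem_Ico.2 ⟨hT s hs, by omega⟩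
  refine (Finset.sum_le_sum_of_subset_of_nonneg hsub fun _ _ _ => by positivity).trans ?_
  refine (hIco _ (by omega)).trans ?_
  gcongr
  have : 0 ≤ ((n + T.sup id + 1 : ℕ) : ℝ) ^ (-α) := by positivity
  linarith

/-- Only the lags `k - i` matter, and they are distinct along the family. This covers both a fixed
innovation with varying `k` and a fixed `k` with varying innovation. -/
theorem sum_abs_maCoeff_le_of_injOn {ι : Type*} {b : ℕ → ℝ} (s : Finset ι) (t : Finset ℕ)
    (k i : ι → ℤ) (hinj : Set.InjOn (fun x => k x - i x) s)
    (ht : ∀ x ∈ s, i x ≤ k x → (k x - i x).toNat ∈ t) :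
    ∑ x ∈ s, |maCoeff b (k x) (i x)| ≤ ∑ j ∈ t, |b j| := by
  classical
  have h1 : ∑ x ∈ s, |maCoeff b (k x) (i x)| =
      ∑ x ∈ s with i x ≤ k x, |b (k x - i x).toNat| := by
    rw [Finset.sum_filter]
    refine Finset.sum_congr rfl fun x _ => ?_
    unfold maCoeff
    split_ifs <;> simp
  have h2 : Set.InjOn (fun x => (k x - i x).toNat) (s.filter fun x => i x ≤ k x) := by
    intro x hx y hy hxy
    simp only [Finset.coe_filter, Set.mem_ofPred_eq] at hx hy
    refine hinj hx.1 hy.1 ?_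
    simp only at hxy ⊢
    omega
  rw [h1, ← Finset.sum_image (f := fun j => |b j|) h2]
  refine Finset.sum_le_sum_of_subset_of_nonneg ?_ fun _ _ _ => abs_nonneg _
  intro j hj
  obtain ⟨x, hx, rfl⟩ := Finset.mem_image.1 hj
  rw [Finset.mem_filter] at hx
  exact ht x hx.1 hx.2

theorem sum_abs_maCoeff_le_tsum {ι : Type*} {b : ℕ → ℝ} (hb : Summable fun j => |b j|)
    (s : Finset ι) (k i : ι → ℤ) (hinj : Set.InjOn (fun x => k x - i x) s) :
    ∑ x ∈ s, |maCoeff b (k x) (i x)| ≤ ∑' j, |b j| :=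
  (sum_abs_maCoeff_le_of_injOn s (s.image fun x => (k x - i x).toNat) k i hinj
    fun _ hx _ => Finset.mem_image_of_mem _ hx).trans
    (hb.sum_le_tsum _ fun _ _ => abs_nonneg _)

theorem injOn_cast_sub (s : Finset ℕ) (i : ℤ) :
    Set.InjOn (fun k : ℕ => (k : ℤ) - i) s := by
  intro x _ y _ h
  simp only at h
  omega

theorem injOn_const_sub (s : Finset ℤ) (k : ℤ) : Set.InjOn (fun i : ℤ => k - i) s := by
  intro x _ y _ h
  simp only at h
  omega

/-- Schur's test: row sums and column sums of the coefficient matrix are both at most `∑ |b j|`. -/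
theorem sum_sq_maCoeff_le_of_summable {b : ℕ → ℝ} (hb : Summable fun j => |b j|) (n : ℕ)
    (I : Finset ℤ) :
    ∑ i ∈ I, (∑ k ∈ Finset.Icc 1 n, |maCoeff b (k : ℤ) i|) ^ 2 ≤ (∑' j, |b j|) ^ 2 * n := by
  set B := ∑' j, |b j|
  have hB : 0 ≤ B := tsum_nonneg fun _ => abs_nonneg _
  calc ∑ i ∈ I, (∑ k ∈ Finset.Icc 1 n, |maCoeff b (k : ℤ) i|) ^ 2
      ≤ ∑ i ∈ I, B * ∑ k ∈ Finset.Icc 1 n, |maCoeff b (k : ℤ) i| := by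
        refine Finset.sum_le_sum fun i _ => ?_
        rw [sq]
        refine mul_le_mul_of_nonneg_right ?_ (Finset.sum_nonneg fun _ _ => abs_nonneg _)
        exact sum_abs_maCoeff_le_tsum hb _ (fun k : ℕ => (k : ℤ)) (fun _ => i) (injOn_cast_sub _ i)
    _ = B * ∑ k ∈ Finset.Icc 1 n, ∑ i ∈ I, |maCoeff b (k : ℤ) i| := by
        rw [← Finset.mul_sum, Finset.sum_comm]
    _ ≤ B * ∑ k ∈ Finset.Icc 1 n, B := by
        gcongr with k
        exact sum_abs_maCoeff_le_tsum hb _ (fun _ => (k : ℤ)) (fun i => i) (injOn_const_sub _ k)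
    _ = B ^ 2 * n := by simp; ring

/-- Innovations after time `n` have no effect. Each of the `2n` indices in `(-n, n]` only sees lags
below `2n`, giving `u i = O(n ^ d)`. For `i ≤ -n` all lags exceed `|i|`, giving `u i = O(n |i| ^
(d-1))`; the squares are summable because `2d < 1`, with tail `n² * n ^ (2d-1)`. -/
theorem sum_sq_maCoeff_le_of_rpow {b : ℕ → ℝ} {d c : ℝ} (hd0 : 0 < d) (hd : d < 1 / 2)
    (hc : 0 ≤ c) (hb : ∀ j : ℕ, |b j| ≤ c * ((j : ℝ) + 1) ^ (d - 1)) {n : ℕ} (hn : 1 ≤ n)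
    (I : Finset ℤ) :
    ∑ i ∈ I, (∑ k ∈ Finset.Icc 1 n, |maCoeff b (k : ℤ) i|) ^ 2 ≤
      (2 * (c * 2 ^ d / d) ^ 2 + c ^ 2 * (2 / (1 - 2 * d))) * (n : ℝ) ^ (1 + 2 * d) := by
  have hn0 : (0 : ℝ) < n := by exact_mod_cast hn
  set u : ℤ → ℝ := fun i => ∑ k ∈ Finset.Icc 1 n, |maCoeff b (k : ℤ) i| with hu
  have hu0 : ∀ i, 0 ≤ u i := fun i => Finset.sum_nonneg fun _ _ => abs_nonneg _
  have hhigh : ∀ i : ℤ, (n : ℤ) < i → u i = 0 := by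
    intro i hi
    refine Finset.sum_eq_zero fun k hk => ?_
    rw [Finset.mem_Icc] at hk
    rw [maCoeff, if_neg (by omega), abs_zero]
  have hmid : ∀ i : ℤ, -(n : ℤ) < i → u i ≤ c * 2 ^ d / d * (n : ℝ) ^ d := by
    intro i hi
    calc u i ≤ ∑ j ∈ Finset.range (2 * n), |b j| := by
          refine sum_abs_maCoeff_le_of_injOn _ _ (fun k : ℕ => (k : ℤ)) (fun _ => i)
            (injOn_cast_sub _ i) fun k hk _ => ?_
          rw [Finset.mem_Icc] at hk
          rw [Finset.mem_range]
          omega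
      _ ≤ ∑ j ∈ Finset.range (2 * n), c * ((j : ℝ) + 1) ^ (d - 1) :=
          Finset.sum_le_sum fun j _ => hb j
      _ ≤ c * (((2 * n : ℕ) : ℝ) ^ d / d) := by
          rw [← Finset.mul_sum]
          exact mul_le_mul_of_nonneg_left (sum_range_rpow_le hd0 (by linarith) _) hc
      _ = _ := by
          push_cast
          rw [Real.mul_rpow (by norm_num) hn0.le]; ring
  have hlow : ∀ i : ℤ, i ≤ -(n : ℤ) → u i ≤ n * (c * ((-i).toNat : ℝ) ^ (d - 1)) := by
    intro i hi
    calc u i ≤ ∑ k ∈ Finset.Icc 1 n, c * ((-i).toNat : ℝ) ^ (d - 1) := by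
          refine Finset.sum_le_sum fun k hk => ?_
          rw [Finset.mem_Icc] at hk
          rw [maCoeff, if_pos (by omega)]
          refine (hb _).trans (mul_le_mul_of_nonneg_left ?_ hc)
          refine Real.rpow_le_rpow_of_nonpos ?_ ?_ (by linarith)
          · exact_mod_cast (by omega : 0 < (-i).toNat)
          · exact_mod_cast (by omega : (-i).toNat ≤ ((k : ℤ) - i).toNat + 1)
      _ = _ := by simp
  have hsplit : ∑ i ∈ I, u i ^ 2 ≤ ∑ i ∈ I with -(n : ℤ) < i ∧ i ≤ n, u i ^ 2 +
      ∑ i ∈ I with i ≤ -(n : ℤ), u i ^ 2 := by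
    rw [Finset.sum_filter, Finset.sum_filter, ← Finset.sum_add_distrib]
    refine Finset.sum_le_sum fun i _ => ?_
    have := sq_nonneg (u i)
    by_cases h1 : i ≤ -(n : ℤ)
    · simp [h1]
      split_ifs <;> linarith
    · by_cases h2 : i ≤ n
      · simp [h1, h2, not_le.1 h1]
      · simp [h1, h2, hhigh i (not_le.1 h2)]
  have hA : ∑ i ∈ I with -(n : ℤ) < i ∧ i ≤ n, u i ^ 2 ≤
      2 * (c * 2 ^ d / d) ^ 2 * (n : ℝ) ^ (1 + 2 * d) := by
    have hcard : ((I.filter fun i => -(n : ℤ) < i ∧ i ≤ n).card : ℝ) ≤ 2 * n := by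
      have h : (I.filter fun i => -(n : ℤ) < i ∧ i ≤ n).card ≤ (Finset.Ioc (-(n : ℤ)) n).card := by
        refine Finset.card_le_card fun i hi => ?_
        rw [Finset.mem_filter] at hi
        exact Finset.mem_Ioc.2 hi.2
      rw [Int.card_Ioc] at h
      have : (I.filter fun i => -(n : ℤ) < i ∧ i ≤ n).card ≤ 2 * n := by omega
      exact_mod_cast this
    calc ∑ i ∈ I with -(n : ℤ) < i ∧ i ≤ n, u i ^ 2
        ≤ ∑ i ∈ I with -(n : ℤ) < i ∧ i ≤ n, (c * 2 ^ d / d * (n : ℝ) ^ d) ^ 2 := by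
          refine Finset.sum_le_sum fun i hi => ?_
          rw [Finset.mem_filter] at hi
          exact pow_le_pow_left₀ (hu0 i) (hmid i hi.2.1) 2
      _ ≤ 2 * n * (c * 2 ^ d / d * (n : ℝ) ^ d) ^ 2 := by
          rw [Finset.sum_const, nsmul_eq_mul]; gcongr
      _ = _ := by
          rw [Real.rpow_add hn0, Real.rpow_one, two_mul d, Real.rpow_add hn0]; ring
  have hB : ∑ i ∈ I with i ≤ -(n : ℤ), u i ^ 2 ≤
      c ^ 2 * (2 / (1 - 2 * d)) * (n : ℝ) ^ (1 + 2 * d) := by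
    have hinj : Set.InjOn (fun i : ℤ => (-i).toNat) (I.filter fun i => i ≤ -(n : ℤ)) := by
      intro x hx y hy h
      simp only [Finset.coe_filter, Set.mem_ofPred_eq] at hx hy
      simp only at h
      omega
    calc ∑ i ∈ I with i ≤ -(n : ℤ), u i ^ 2
        ≤ ∑ i ∈ I with i ≤ -(n : ℤ), (n * c) ^ 2 * ((-i).toNat : ℝ) ^ (-(1 - 2 * d) - 1) := by
          refine Finset.sum_le_sum fun i hi => ?_
          rw [Finset.mem_filter] at hi
          refine (pow_le_pow_left₀ (hu0 i) (hlow i hi.2) 2).trans_eq ?_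
          have : (0 : ℝ) < (-i).toNat := by exact_mod_cast (by omega : 0 < (-i).toNat)
          rw [show -(1 - 2 * d) - 1 = (d - 1) + (d - 1) by ring, Real.rpow_add this]; ring
      _ = (n * c) ^ 2 * ∑ s ∈ ((I.filter fun i => i ≤ -(n : ℤ)).image fun i => (-i).toNat : Finset ℕ),
            (s : ℝ) ^ (-(1 - 2 * d) - 1) := by
          rw [← Finset.mul_sum, Finset.sum_image (f := fun s : ℕ => (s : ℝ) ^ (-(1 - 2 * d) - 1))
            hinj]
      _ ≤ (n * c) ^ 2 * (2 / (1 - 2 * d) * (n : ℝ) ^ (-(1 - 2 * d))) := by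
          gcongr
          refine sum_rpow_tail_le (by linarith) (by linarith) hn _ fun s hs => ?_
          obtain ⟨i, hi, rfl⟩ := Finset.mem_image.1 hs
          rw [Finset.mem_filter] at hi
          omega
      _ = _ := by
          rw [show 1 + 2 * d = 2 + -(1 - 2 * d) by ring, Real.rpow_add hn0 2, Real.rpow_two]; ring
  calc _ ≤ _ := hsplit
    _ ≤ _ := add_le_add hA hB
    _ = _ := by ring

theorem LMSDCoeff.exists_sum_sq_maCoeff_le {d : ℝ} {b : ℕ → ℝ} (hb : LMSDCoeff d b) (hd0 : 0 ≤ d)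
    (hd : d < 1 / 2) : ∃ C : ℝ, 0 ≤ C ∧ ∀ n : ℕ, 1 ≤ n → ∀ I : Finset ℤ,
      ∑ i ∈ I, (∑ k ∈ Finset.Icc 1 n, |maCoeff b (k : ℤ) i|) ^ 2 ≤
        C * (n : ℝ) ^ (1 + 2 * d) := by
  rcases hd0.eq_or_lt with rfl | hpos
  · obtain ⟨C, a, -, ha, hCa⟩ := hb.2 rfl
    have hs : Summable fun j => |b j| := by
      refine (summable_of_isBigO_nat (g := fun j : ℕ => |C * a ^ j|) ?_ ?_)
      · simpa [abs_mul] using (summable_geometric_of_lt_one (abs_nonneg a) ha).mul_left |C|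
      · exact hCa.isBigO.abs_abs
    refine ⟨(∑' j, |b j|) ^ 2, by positivity, fun n _ I => ?_⟩
    simpa using sum_sq_maCoeff_le_of_summable hs n I
  · obtain ⟨C, -, hC⟩ := hb.1 hpos
    have hO : b =O[atTop] fun j : ℕ => ((j : ℝ) + 1) ^ (d - 1) := by
      refine hC.isBigO.trans ?_
      refine Asymptotics.IsBigO.const_mul_left ?_ C
      -- The constant comes from `j ≥ (j+1) / 2`. The shift to `j + 1` keeps the comparison sequence
      -- nonzero at `j = 0`, so that the bound extends to every `j`.
      refine Asymptotics.IsBigO.of_bound (2 ^ (1 - d)) ?_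
      filter_upwards [eventually_ge_atTop 1] with j hj
      have hj' : (1 : ℝ) ≤ j := by exact_mod_cast hj
      rw [Real.norm_of_nonneg (by positivity), Real.norm_of_nonneg (by positivity),
        show (2 : ℝ) ^ (1 - d) = (1 / 2) ^ (d - 1) by
          rw [one_div, Real.inv_rpow (by norm_num), ← Real.rpow_neg (by norm_num), neg_sub],
        ← Real.mul_rpow (by norm_num) (by positivity)]
      exact Real.rpow_le_rpow_of_nonpos (by positivity) (by linarith) (by linarith)
    obtain ⟨c, hc, hbound⟩ := Asymptotics.bound_of_isBigO_nat_atTop hO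
    refine ⟨_, ?_, fun n hn I => sum_sq_maCoeff_le_of_rpow hpos hd hc.le (fun j => ?_) hn I⟩
    · have : 0 < 1 - 2 * d := by linarith
      positivity
    · have hj : (0 : ℝ) < ((j : ℝ) + 1) ^ (d - 1) := by positivity
      simpa [abs_of_pos hj] using hbound (x := j) hj.ne'

theorem LMSDCoeff.summable_sq {d : ℝ} {b : ℕ → ℝ} (hb : LMSDCoeff d b) (hd0 : 0 ≤ d)
    (hd : d < 1 / 2) : Summable fun j => b j ^ 2 := by
  obtain ⟨C, -, hC⟩ := hb.exists_sum_sq_maCoeff_le hd0 hd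
  refine summable_of_sum_range_le (c := C) (fun _ => sq_nonneg _) fun N => ?_
  -- For `n = 1` the inner sum at `i = 1 - j` is the single term `|b j|`.
  have h := hC 1 le_rfl ((Finset.range N).image fun j : ℕ => (1 : ℤ) - j)
  rw [Finset.sum_image (fun x _ y _ hxy => by omega)] at h
  simpa [maCoeff] using h

theorem sum_maCoeff_sq_le_tsum {b : ℕ → ℝ} (hb : Summable fun j => b j ^ 2) (k : ℤ)
    (I : Finset ℤ) : ∑ i ∈ I, maCoeff b k i ^ 2 ≤ ∑' j, b j ^ 2 := by
  have h := sum_abs_maCoeff_le_tsum (b := fun j => b j ^ 2) (by simpa using hb) I (fun _ => k)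
    (fun i => i) (injOn_const_sub I k)
  simp only [abs_pow, sq_abs] at h
  refine le_trans (le_of_eq (Finset.sum_congr rfl fun i _ => ?_)) h
  unfold maCoeff
  split_ifs <;> simp

/-- A single window `[-L, n]` of innovations serves all `k ≤ n` at once: in `h k` it amounts to
truncating at lag `k + L`. -/
theorem sum_maCoeff_Icc {b : ℕ → ℝ} {n k : ℕ} (hk : k ≤ n) (L : ℕ) (f : ℝ → ℤ → ℝ)
    (hf : ∀ i, f 0 i = 0) :
    ∑ i ∈ Finset.Icc (-(L : ℤ)) n, f (maCoeff b k i) i =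
      ∑ j ∈ Finset.range (k + L + 1), f (b j) ((k : ℤ) - j) := by
  symm
  refine Finset.sum_of_injOn (fun j : ℕ => (k : ℤ) - j) ?_ ?_ ?_ ?_
  · intro x _ y _ h
    simp only at h
    omega
  · intro j hj
    simp only [Finset.coe_range, Set.mem_Iio] at hj
    simp only [Finset.coe_Icc, Set.mem_Icc]
    omega
  · intro i hi hni
    rw [Finset.mem_Icc] at hi
    have : ¬ i ≤ k := by
      intro hik
      refine hni ⟨(k - i).toNat, ?_, ?_⟩
      · simp only [Finset.coe_range, Set.mem_Iio]; omega
      · simp only; omega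
    rw [maCoeff, if_neg this, hf]
  · intro j _
    simp [maCoeff]

/-! ### Normalized exponentials of Gaussian linear forms -/

/-- `exp (∑ c i * Z i)` over the indices in `I`, normalized to have mean one when the `Z i` are
independent centred Gaussians of variance `v`. -/
noncomputable def wickExp {Ω : Type*} (v : ℝ≥0) (Z : ℤ → Ω → ℝ) (c : ℤ → ℝ) (I : Finset ℤ) (ω : Ω) :
    ℝ := Real.exp (∑ i ∈ I, (c i * Z i ω - v * c i ^ 2 / 2))

theorem wickExp_pos {Ω : Type*} (v : ℝ≥0) (Z : ℤ → Ω → ℝ) (c : ℤ → ℝ) (I : Finset ℤ) (ω : Ω) :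
    0 < wickExp v Z c I ω := Real.exp_pos _

theorem wickExp_insert {Ω : Type*} {v : ℝ≥0} {Z : ℤ → Ω → ℝ} {c : ℤ → ℝ} {I : Finset ℤ}
    {i : ℤ} (hi : i ∉ I) (ω : Ω) :
    wickExp v Z c (insert i I) ω =
      wickExp v Z c I ω * Real.exp (c i * Z i ω - v * c i ^ 2 / 2) := by
  rw [wickExp, Finset.sum_insert hi, add_comm, Real.exp_add, wickExp]

theorem wickExp_eq_comp {Ω : Type*} {v : ℝ≥0} {Z : ℤ → Ω → ℝ} (c : ℤ → ℝ) (I : Finset ℤ) (ω : Ω) :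
    wickExp v Z c I ω =
      (fun z : I → ℝ => Real.exp (∑ i : I, (c i * z i - v * c i ^ 2 / 2))) fun j : I => Z j ω := by
  rw [wickExp, ← Finset.sum_coe_sort]

theorem abs_exp_sub_one_le_mul_exp (t : ℝ) : |Real.exp t - 1| ≤ |t| * Real.exp |t| := by
  rcases le_total 0 t with h | h
  · rw [abs_of_nonneg h, abs_of_nonneg (by linarith [Real.add_one_le_exp t])]
    have h1 := mul_le_mul_of_nonneg_left (Real.add_one_le_exp (-t)) (Real.exp_pos t).le
    rw [← Real.exp_add, add_neg_cancel, Real.exp_zero] at h1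
    linarith
  · rw [abs_of_nonpos h, abs_of_nonpos (by linarith [Real.exp_le_one_iff.2 h])]
    have h1 : 1 ≤ Real.exp (-t) := Real.one_le_exp (by linarith)
    nlinarith [Real.add_one_le_exp t]

/-- The factor `|c|` gives each increment its size; what remains depends on `z` alone, uniformly in
`|c| ≤ R`, and has all moments for Gaussian `z`. -/
theorem abs_exp_linear_sub_one_le {v R c z : ℝ} (hv : 0 ≤ v) (hc : |c| ≤ R) :
    |Real.exp (c * z - v * c ^ 2 / 2) - 1| ≤ |c| * Real.exp ((R + 1) * (|z| + v * R)) := by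
  have hR : 0 ≤ R := (abs_nonneg c).trans hc
  set w := |z| + v * R with hw
  have hw0 : 0 ≤ w := by positivity
  have ht : |c * z - v * c ^ 2 / 2| ≤ |c| * w := by
    refine (abs_sub _ _).trans ?_
    rw [abs_mul, abs_of_nonneg (show 0 ≤ v * c ^ 2 / 2 by positivity), hw, ← sq_abs c]
    have h1 : v * |c| * |c| ≤ v * |c| * R := mul_le_mul_of_nonneg_left hc (by positivity)
    have h2 : 0 ≤ v * |c| * |c| := by positivity
    nlinarith
  calc _ ≤ _ := abs_exp_sub_one_le_mul_exp _
    _ ≤ |c| * w * Real.exp (R * w) := by gcongr; exact ht.trans (by gcongr)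
    _ ≤ |c| * Real.exp w * Real.exp (R * w) := by
        gcongr; linarith [Real.add_one_le_exp w]
    _ = _ := by rw [mul_assoc, ← Real.exp_add]; ring_nf

/-- Jensen's inequality with weights `w i / ∑ w`; after integration it plays the part of Minkowski's
inequality. -/
theorem sum_mul_pow_succ_le {ι : Type*} (s : Finset ι) (w u : ι → ℝ) (hw : ∀ i ∈ s, 0 ≤ w i)
    (hu : ∀ i ∈ s, 0 ≤ u i) (q : ℕ) :
    (∑ i ∈ s, w i * u i) ^ (q + 1) ≤ (∑ i ∈ s, w i) ^ q * ∑ i ∈ s, w i * u i ^ (q + 1) := by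
  rcases (Finset.sum_nonneg hw).eq_or_lt with h | h
  · have h0 := (Finset.sum_eq_zero_iff_of_nonneg hw).1 h.symm
    rw [Finset.sum_eq_zero fun i hi => show w i * u i = 0 by rw [h0 i hi, zero_mul],
      Finset.sum_eq_zero fun i hi => show w i * u i ^ (q + 1) = 0 by rw [h0 i hi, zero_mul]]
    simp
  · set W := ∑ i ∈ s, w i
    have := Real.pow_arith_mean_le_arith_mean_pow s (fun i => w i / W) u
      (fun i hi => div_nonneg (hw i hi) h.le) (by rw [← Finset.sum_div, div_self h.ne']) hu (q + 1)
    simp only [div_mul_eq_mul_div] at this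
    rw [← Finset.sum_div, ← Finset.sum_div, div_pow, div_le_div_iff₀ (by positivity) h,
      pow_succ W, ← mul_assoc] at this
    have := le_of_mul_le_mul_right this h
    linarith

theorem ProbabilityTheory.iIndepFun.indepFun_comp_finset {Ω : Type*} [MeasurableSpace Ω]
    {P : Measure Ω} {Z : ℤ → Ω → ℝ} (hZ : iIndepFun Z P) (hm : ∀ i, Measurable (Z i))
    {I : Finset ℤ} {i : ℤ} (hi : i ∉ I) {φ : (I → ℝ) → ℝ} {ψ : ℝ → ℝ} (hφ : Measurable φ)
    (hψ : Measurable ψ) :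
    IndepFun (fun ω => φ fun j : I => Z j ω) (fun ω => ψ (Z i ω)) P := by
  have h := hZ.indepFun_finset I {i} (Finset.disjoint_singleton_right.2 hi) hm
  exact h.comp (φ := φ) (ψ := fun z : (({i} : Finset ℤ) → ℝ) => ψ (z ⟨i, by simp⟩)) hφ
    (hψ.comp (measurable_pi_apply _))

section

variable {Ω : Type*} [MeasurableSpace Ω] {P : Measure Ω} {v : ℝ≥0} {Z : ℤ → Ω → ℝ}

theorem integral_wickExp_pow (hm : ∀ i, Measurable (Z i)) (hZ : iIndepFun Z P)
    (hg : ∀ i, P.map (Z i) = gaussianReal 0 v) (c : ℤ → ℝ) (I : Finset ℤ) (q : ℕ) :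
    ∫ ω, wickExp v Z c I ω ^ q ∂P =
      Real.exp (v / 2 * ((q : ℝ) ^ 2 - q) * ∑ i ∈ I, c i ^ 2) := by
  have hX : iIndepFun (fun i ω => c i * Z i ω) P :=
    hZ.comp (fun i x => c i * x) fun i => measurable_const_mul (c i)
  have hs := hX.mgf_sum (fun i => (hm i).const_mul (c i)) I (t := (q : ℝ))
  have hone : ∀ i, mgf (fun ω => c i * Z i ω) P q = Real.exp (v * (c i * q) ^ 2 / 2) := by
    intro i
    have := mgf_gaussianReal (hg i) (c i * q)
    rw [zero_mul, zero_add] at this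
    rw [← this]
    unfold mgf
    congr 1
    ext ω
    ring_nf
  simp only [hone] at hs
  rw [← Real.exp_sum] at hs
  have e : ∀ ω, wickExp v Z c I ω ^ q = Real.exp (-(q * (v / 2) * ∑ i ∈ I, c i ^ 2)) *
      Real.exp (q * (∑ i ∈ I, fun ω => c i * Z i ω) ω) := by
    intro ω
    rw [wickExp, ← Real.exp_nat_mul, ← Real.exp_add, Finset.sum_apply, Finset.sum_sub_distrib]
    congr 1
    have : ∑ i ∈ I, (v : ℝ) * c i ^ 2 / 2 = v / 2 * ∑ i ∈ I, c i ^ 2 := by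
      rw [Finset.mul_sum]; exact Finset.sum_congr rfl fun i _ => by ring
    rw [this]
    ring
  simp only [e]
  rw [integral_const_mul]
  unfold mgf at hs
  rw [hs, ← Real.exp_add]
  congr 1
  have : ∑ i ∈ I, (v : ℝ) * (c i * q) ^ 2 / 2 = v / 2 * (q : ℝ) ^ 2 * ∑ i ∈ I, c i ^ 2 := by
    rw [Finset.mul_sum]; exact Finset.sum_congr rfl fun i _ => by ring
  rw [this]
  ring

theorem integral_wickExp_pow_le (hm : ∀ i, Measurable (Z i)) (hZ : iIndepFun Z P)
    (hg : ∀ i, P.map (Z i) = gaussianReal 0 v) {c : ℤ → ℝ} {I : Finset ℤ} {Q : ℝ}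
    (hQ : ∑ i ∈ I, c i ^ 2 ≤ Q) (q : ℕ) :
    ∫ ω, wickExp v Z c I ω ^ q ∂P ≤ Real.exp (v / 2 * (q : ℝ) ^ 2 * Q) := by
  rw [integral_wickExp_pow hm hZ hg]
  have h0 : 0 ≤ ∑ i ∈ I, c i ^ 2 := Finset.sum_nonneg fun _ _ => sq_nonneg _
  gcongr
  have : (0 : ℝ) ≤ q := q.cast_nonneg
  linarith

theorem integrable_exp_mul_of_map_eq {X : Ω → ℝ} (hX : Measurable X)
    (hg : P.map X = gaussianReal 0 v) (t : ℝ) : Integrable (fun ω => Real.exp (t * X ω)) P := by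
  have h := integrable_exp_mul_gaussianReal (μ := 0) (v := v) t
  rw [← hg] at h
  exact h.comp_measurable hX

theorem hasMoments_exp_linear {X : Ω → ℝ} (hX : Measurable X)
    (hg : P.map X = gaussianReal 0 v) (s t : ℝ) :
    HasMoments (fun ω => Real.exp (s * X ω - t)) P := by
  refine .of_integrable_abs_pow (by fun_prop) fun q => ?_
  have := (integrable_exp_mul_of_map_eq hX hg (q * s)).mul_const (Real.exp (-(q * t)))
  refine this.congr (ae_of_all _ fun ω => ?_)
  simp only
  rw [abs_of_pos (Real.exp_pos _), ← Real.exp_nat_mul, ← Real.exp_add]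
  ring_nf

theorem hasMoments_exp_abs {X : Ω → ℝ} (hX : Measurable X)
    (hg : P.map X = gaussianReal 0 v) (s t : ℝ) :
    HasMoments (fun ω => Real.exp (s * (|X ω| + t))) P := by
  refine .of_integrable_abs_pow (by fun_prop) fun q => ?_
  have := (integrable_exp_mul_abs (integrable_exp_mul_of_map_eq hX hg (q * s))
    (integrable_exp_mul_of_map_eq hX hg (-(q * s)))).mul_const (Real.exp (q * s * t))
  refine this.congr (ae_of_all _ fun ω => ?_)
  simp only
  rw [abs_of_pos (Real.exp_pos _), ← Real.exp_nat_mul, ← Real.exp_add]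
  ring_nf

variable [IsProbabilityMeasure P]

theorem hasMoments_wickExp (hm : ∀ i, Measurable (Z i))
    (hg : ∀ i, P.map (Z i) = gaussianReal 0 v) (c : ℤ → ℝ) (I : Finset ℤ) :
    HasMoments (wickExp v Z c I) P := by
  induction I using Finset.induction_on with
  | empty =>
    have : wickExp v Z c ∅ = fun _ => 1 := by ext; simp [wickExp]
    rw [this]
    exact .const 1
  | insert i I hi ih =>
    have : wickExp v Z c (insert i I) = fun ω =>
        wickExp v Z c I ω * Real.exp (c i * Z i ω - v * c i ^ 2 / 2) :=
      funext (wickExp_insert hi)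
    rw [this]
    exact ih.mul (hasMoments_exp_linear (hm i) (hg i) _ _)

theorem integral_exp_linear_sub_one (hm : ∀ i, Measurable (Z i)) (hZ : iIndepFun Z P)
    (hg : ∀ i, P.map (Z i) = gaussianReal 0 v) (s : ℝ) (i : ℤ) :
    ∫ ω, (Real.exp (s * Z i ω - v * s ^ 2 / 2) - 1) ∂P = 0 := by
  have h := integral_wickExp_pow hm hZ hg (fun _ => s) {i} 1
  simp only [wickExp, Finset.sum_singleton, pow_one, Nat.cast_one, one_pow, sub_self, mul_zero,
    zero_mul, Real.exp_zero] at h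
  rw [integral_sub (hasMoments_exp_linear (hm i) (hg i) _ _).integrable (integrable_const 1), h]
  simp

/-- The past exponential and the new factor are independent, so their moments multiply, with bounds
uniform in `k`. -/
theorem integral_increment_pow_le (hm : ∀ i, Measurable (Z i)) (hZ : iIndepFun Z P)
    (hg : ∀ i, P.map (Z i) = gaussianReal 0 v) {R Q : ℝ} (K : Finset ℕ) {c : ℕ → ℤ → ℝ}
    (hR : ∀ k i, |c k i| ≤ R) {I : Finset ℤ} (hQ : ∀ k, ∑ i ∈ I, c k i ^ 2 ≤ Q) {i : ℤ}
    (hi : i ∉ I) (q : ℕ) (hq : Even (q + 1)) :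
    ∫ ω, (∑ k ∈ K, wickExp v Z (c k) I ω *
      (Real.exp (c k i * Z i ω - v * c k i ^ 2 / 2) - 1)) ^ (q + 1) ∂P ≤
    (∫ x, Real.exp ((R + 1) * (|x| + v * R)) ^ (q + 1) ∂(gaussianReal 0 v)) *
      Real.exp (v / 2 * ((q + 1 : ℕ) : ℝ) ^ 2 * Q) * (∑ k ∈ K, |c k i|) ^ (q + 1) := by
  set G : ℝ → ℝ := fun x => Real.exp ((R + 1) * (|x| + v * R)) with hG
  have hGm : Measurable G := by fun_prop
  have hGZ : HasMoments (fun ω => G (Z i ω)) P := hasMoments_exp_abs (hm i) (hg i) _ _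
  have hM := fun k => hasMoments_wickExp (P := P) hm hg (c k) I
  have hGint : ∫ ω, G (Z i ω) ^ (q + 1) ∂P = ∫ x, G x ^ (q + 1) ∂(gaussianReal 0 v) := by
    rw [← hg i, integral_map (hm i).aemeasurable (by fun_prop)]
  have hpt : ∀ ω, (∑ k ∈ K, wickExp v Z (c k) I ω *
      (Real.exp (c k i * Z i ω - v * c k i ^ 2 / 2) - 1)) ^ (q + 1) ≤
      (∑ k ∈ K, |c k i|) ^ q *
        ∑ k ∈ K, |c k i| * (wickExp v Z (c k) I ω ^ (q + 1) * G (Z i ω) ^ (q + 1)) := by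
    intro ω
    rw [← hq.pow_abs]
    calc _ ≤ (∑ k ∈ K, |c k i| * (wickExp v Z (c k) I ω * G (Z i ω))) ^ (q + 1) := by
          refine pow_le_pow_left₀ (abs_nonneg _) ?_ _
          refine (Finset.abs_sum_le_sum_abs _ _).trans (Finset.sum_le_sum fun k _ => ?_)
          rw [abs_mul, abs_of_pos (wickExp_pos v Z (c k) I ω), mul_left_comm]
          exact mul_le_mul_of_nonneg_left (abs_exp_linear_sub_one_le v.2 (hR k i))
            (wickExp_pos v Z (c k) I ω).le
      _ ≤ _ := sum_mul_pow_succ_le K _ _ (fun _ _ => abs_nonneg _)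
          (fun k _ => (mul_pos (wickExp_pos v Z (c k) I ω) (Real.exp_pos _)).le) q
      _ = _ := by simp only [mul_pow, hG]
  have hprod : ∀ k, HasMoments
      (fun ω => |c k i| * (wickExp v Z (c k) I ω ^ (q + 1) * G (Z i ω) ^ (q + 1))) P :=
    fun k => (((hM k).pow (q + 1)).mul (hGZ.pow (q + 1))).const_mul _
  have hL : HasMoments (fun ω => (∑ k ∈ K, wickExp v Z (c k) I ω *
      (Real.exp (c k i * Z i ω - v * c k i ^ 2 / 2) - 1)) ^ (q + 1)) P :=
    (HasMoments.sum K fun k _ => (hM k).mul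
      ((hasMoments_exp_linear (hm i) (hg i) _ _).sub_const 1)).pow _
  refine (integral_mono hL.integrable
    ((HasMoments.sum K fun k _ => hprod k).const_mul _).integrable hpt).trans ?_
  rw [integral_const_mul, integral_finsetSum K fun k _ => (hprod k).integrable]
  have hterm : ∀ k ∈ K,
      ∫ ω, |c k i| * (wickExp v Z (c k) I ω ^ (q + 1) * G (Z i ω) ^ (q + 1)) ∂P ≤
      |c k i| * ((∫ x, G x ^ (q + 1) ∂(gaussianReal 0 v)) *
        Real.exp (v / 2 * ((q + 1 : ℕ) : ℝ) ^ 2 * Q)) := by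
    intro k _
    rw [integral_const_mul]
    refine mul_le_mul_of_nonneg_left ?_ (abs_nonneg _)
    have hind : IndepFun (fun ω => wickExp v Z (c k) I ω ^ (q + 1))
        (fun ω => G (Z i ω) ^ (q + 1)) P := by
      simp only [wickExp_eq_comp]
      exact hZ.indepFun_comp_finset hm hi
        (φ := fun z => Real.exp (∑ j : I, (c k j * z j - v * c k j ^ 2 / 2)) ^ (q + 1))
        (ψ := fun x => G x ^ (q + 1)) (by fun_prop) (by fun_prop)
    rw [hind.integral_fun_mul_eq_mul_integral ((hM k).pow _).aestronglyMeasurable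
      (hGZ.pow _).aestronglyMeasurable, hGint, mul_comm]
    refine mul_le_mul_of_nonneg_left (integral_wickExp_pow_le hm hZ hg (hQ k) _) ?_
    exact integral_nonneg fun x => pow_nonneg (Real.exp_pos _).le _
  refine (mul_le_mul_of_nonneg_left (Finset.sum_le_sum hterm)
    (pow_nonneg (Finset.sum_nonneg fun _ _ => abs_nonneg _) _)).trans_eq ?_
  rw [← Finset.sum_mul, pow_succ]
  ring

theorem exists_integral_sum_wickExp_sub_one_pow_le (hm : ∀ i, Measurable (Z i))
    (hZ : iIndepFun Z P) (hg : ∀ i, P.map (Z i) = gaussianReal 0 v) (R Q : ℝ) (m : ℕ) :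
    ∃ A : ℝ, 0 ≤ A ∧ ∀ (K : Finset ℕ) (c : ℕ → ℤ → ℝ), (∀ k i, |c k i| ≤ R) →
      (∀ k I, ∑ i ∈ I, c k i ^ 2 ≤ Q) → ∀ I : Finset ℤ,
      ∫ ω, (∑ k ∈ K, (wickExp v Z (c k) I ω - 1)) ^ (2 * (m + 1)) ∂P ≤
        (A * ∑ i ∈ I, (∑ k ∈ K, |c k i|) ^ 2) ^ (m + 1) := by
  set B : ℝ := (∫ x, Real.exp ((R + 1) * (|x| + v * R)) ^ (2 * m + 1 + 1) ∂(gaussianReal 0 v)) *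
      Real.exp (v / 2 * ((2 * m + 1 + 1 : ℕ) : ℝ) ^ 2 * Q) with hB
  have hB0 : 0 ≤ B := mul_nonneg
    (integral_nonneg fun x => pow_nonneg (Real.exp_pos _).le _) (Real.exp_pos _).le
  -- Adding 1 gives `B ≤ (1 + B) ^ (m+1)`, which avoids taking a root of `B`.
  refine ⟨3 * 4 ^ (m + 1) * (1 + B), by positivity, fun K c hR hQ I => ?_⟩
  induction I using Finset.induction_on with
  | empty => simp [wickExp]
  | insert i I hi ih =>
    set X : Ω → ℝ := fun ω => ∑ k ∈ K, (wickExp v Z (c k) I ω - 1) with hX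
    set g : ℕ → ℝ → ℝ := fun k x => Real.exp (c k i * x - v * c k i ^ 2 / 2) - 1 with hgdef
    set Y : Ω → ℝ := fun ω => ∑ k ∈ K, wickExp v Z (c k) I ω * g k (Z i ω) with hY
    have hM := fun k => hasMoments_wickExp (P := P) hm hg (c k) I
    have hgm : ∀ k, HasMoments (fun ω => g k (Z i ω)) P := fun k =>
      (hasMoments_exp_linear (hm i) (hg i) _ _).sub_const 1
    have hXm : HasMoments X P := .sum K fun k _ => (hM k).sub_const 1
    have hYm : HasMoments Y P := .sum K fun k _ => (hM k).mul (hgm k)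
    have hXY : ∀ ω, ∑ k ∈ K, (wickExp v Z (c k) (insert i I) ω - 1) = X ω + Y ω := by
      intro ω
      rw [hX, hY, ← Finset.sum_add_distrib]
      refine Finset.sum_congr rfl fun k _ => ?_
      rw [wickExp_insert hi, hgdef]
      ring
    -- Martingale property: `X` and the exponentials over `I` depend only on innovations in `I`, and
    -- each `g k (Z i)` is centred and independent of those.
    have h0 : ∫ ω, X ω ^ (2 * m + 1) * Y ω ∂P = 0 := by
      have e : ∀ ω, X ω ^ (2 * m + 1) * Y ω =
          ∑ k ∈ K, (X ω ^ (2 * m + 1) * wickExp v Z (c k) I ω) * g k (Z i ω) := by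
        intro ω
        rw [hY, Finset.mul_sum]
        exact Finset.sum_congr rfl fun k _ => by ring
      simp only [e]
      rw [integral_finsetSum K fun k _ => (((hXm.pow _).mul (hM k)).mul (hgm k)).integrable]
      refine Finset.sum_eq_zero fun k _ => ?_
      have hind : IndepFun (fun ω => X ω ^ (2 * m + 1) * wickExp v Z (c k) I ω)
          (fun ω => g k (Z i ω)) P := by
        simp only [hX, wickExp_eq_comp]
        exact hZ.indepFun_comp_finset hm hi
          (φ := fun z => (∑ k ∈ K,
            (Real.exp (∑ j : I, (c k j * z j - v * c k j ^ 2 / 2)) - 1)) ^ (2 * m + 1) *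
            Real.exp (∑ j : I, (c k j * z j - v * c k j ^ 2 / 2)))
          (ψ := g k) (by fun_prop) (by fun_prop)
      rw [hind.integral_fun_mul_eq_mul_integral ((hXm.pow _).mul (hM k)).aestronglyMeasurable
        (hgm k).aestronglyMeasurable, hgdef, integral_exp_linear_sub_one hm hZ hg, mul_zero]
    have hYb : ∫ ω, Y ω ^ (2 * (m + 1)) ∂P ≤ ((1 + B) * (∑ k ∈ K, |c k i|) ^ 2) ^ (m + 1) := by
      have h := integral_increment_pow_le hm hZ hg K hR (fun k => hQ k I) hi (2 * m + 1)
        ⟨m + 1, by ring⟩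
      refine h.trans ?_
      rw [← hB, mul_pow, ← pow_mul]
      refine mul_le_mul_of_nonneg_right ?_ (pow_nonneg (Finset.sum_nonneg fun _ _ => abs_nonneg _) _)
      exact (by linarith : B ≤ 1 + B).trans (le_self_pow₀ (by linarith) (by omega))
    have := integral_add_pow_le m hXm hYm h0 (by positivity) (by positivity) ih hYb
    simp only [hXY]
    refine this.trans_eq ?_
    rw [Finset.sum_insert hi]
    ring

end

/-! ### Passage to the limit -/

section

variable {Ω : Type*} [MeasurableSpace Ω] {P : Measure Ω}

theorem exists_subseq_forall_tendsto_ae {ι : Type*} (s : Finset ι)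
    {f : ι → ℕ → Ω → ℝ} {g : ι → Ω → ℝ} (h : ∀ k ∈ s, TendstoInMeasure P (f k) atTop (g k)) :
    ∃ u : ℕ → ℕ, StrictMono u ∧
      ∀ k ∈ s, ∀ᵐ ω ∂P, Tendsto (fun i => f k (u i) ω) atTop (𝓝 (g k ω)) := by
  classical
  induction s using Finset.induction_on with
  | empty => exact ⟨id, strictMono_id, by simp⟩
  | insert k s hk ih =>
    obtain ⟨u, hu, hus⟩ := ih fun j hj => h j (Finset.mem_insert_of_mem hj)
    have hku : TendstoInMeasure P (fun i => f k (u i)) atTop (g k) := fun ε hε =>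
      (h k (Finset.mem_insert_self k s) ε hε).comp hu.tendsto_atTop
    obtain ⟨w, hw, hwk⟩ := hku.exists_seq_tendsto_ae
    refine ⟨u ∘ w, hu.comp hw, fun j hj => ?_⟩
    rcases Finset.mem_insert.1 hj with rfl | hj
    · exact hwk
    · filter_upwards [hus j hj] with ω hω using hω.comp hw.tendsto_atTop

theorem integrable_and_integral_le_of_tendsto_ae {F : ℕ → Ω → ℝ} {f : Ω → ℝ} {B : ℝ}
    (hF : ∀ i, Integrable (F i) P) (hF0 : ∀ i ω, 0 ≤ F i ω) (hB : ∀ i, ∫ ω, F i ω ∂P ≤ B)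
    (hlim : ∀ᵐ ω ∂P, Tendsto (fun i => F i ω) atTop (𝓝 (f ω))) :
    Integrable f P ∧ ∫ ω, f ω ∂P ≤ B := by
  have hfm : AEStronglyMeasurable f P :=
    aestronglyMeasurable_of_tendsto_ae atTop (fun i => (hF i).1) hlim
  have hf0 : 0 ≤ᵐ[P] f := by
    filter_upwards [hlim] with ω hω using ge_of_tendsto' hω fun i => hF0 i ω
  have hle : ∫⁻ ω, ENNReal.ofReal (f ω) ∂P ≤ ENNReal.ofReal B := by
    calc ∫⁻ ω, ENNReal.ofReal (f ω) ∂P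
        = ∫⁻ ω, liminf (fun i => ENNReal.ofReal (F i ω)) atTop ∂P := by
          refine lintegral_congr_ae ?_
          filter_upwards [hlim] with ω hω
          exact ((ENNReal.continuous_ofReal.tendsto _).comp hω).liminf_eq.symm
      _ ≤ liminf (fun i => ∫⁻ ω, ENNReal.ofReal (F i ω) ∂P) atTop :=
          lintegral_liminf_le' fun i => (hF i).1.aemeasurable.ennreal_ofReal
      _ ≤ ENNReal.ofReal B := by
          refine liminf_le_of_le (by isBoundedDefault) fun a ha => ?_
          obtain ⟨i, hi⟩ := ha.exists
          refine hi.trans ?_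
          rw [← ofReal_integral_eq_lintegral_ofReal (hF i) (ae_of_all _ (hF0 i))]
          exact ENNReal.ofReal_le_ofReal (hB i)
  have hfi : Integrable f P := by
    refine ⟨hfm, ?_⟩
    rw [hasFiniteIntegral_iff_ofReal hf0]
    exact hle.trans_lt ENNReal.ofReal_lt_top
  have hB0 : 0 ≤ B := (integral_nonneg (hF0 0)).trans (hB 0)
  refine ⟨hfi, ?_⟩
  rw [← ofReal_integral_eq_lintegral_ofReal hfi hf0] at hle
  exact (ENNReal.ofReal_le_ofReal_iff hB0).1 hle

end

/-! ### Sums of centred noise with independent random weights -/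

/-- Both hypotheses make the joint law a threefold product measure, which can be reassociated. -/
theorem ProbabilityTheory.IndepFun.prodMk_of_prodMk {Ω α β γ : Type*} [MeasurableSpace Ω]
    [MeasurableSpace α] [MeasurableSpace β] [MeasurableSpace γ] {P : Measure Ω}
    [IsProbabilityMeasure P] {f : Ω → α} {g : Ω → β} {h : Ω → γ} (hf : Measurable f)
    (hg : Measurable g) (hh : Measurable h) (hfgh : IndepFun f (fun ω => (g ω, h ω)) P)
    (hgh : IndepFun g h P) : IndepFun (fun ω => (f ω, g ω)) h P := by
  have hfg : IndepFun f g P := hfgh.comp (φ := id) (ψ := Prod.fst) measurable_id measurable_fst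
  have : IsProbabilityMeasure (P.map f) := Measure.isProbabilityMeasure_map hf.aemeasurable
  have : IsProbabilityMeasure (P.map g) := Measure.isProbabilityMeasure_map hg.aemeasurable
  have : IsProbabilityMeasure (P.map h) := Measure.isProbabilityMeasure_map hh.aemeasurable
  rw [indepFun_iff_map_prod_eq_prod_map_map (by fun_prop) (by fun_prop)] at *
  rw [hgh] at hfgh
  rw [← Measure.prodAssoc_prod] at hfgh
  rw [hfg, ← MeasurableEquiv.prodAssoc.map_measurableEquiv_injective.eq_iff, ← hfgh,
    Measure.map_map MeasurableEquiv.prodAssoc.measurable (by fun_prop)]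
  rfl

section

variable {Ω : Type*} [MeasurableSpace Ω] {P : Measure Ω} [IsProbabilityMeasure P]

/-- The weights may depend on each other arbitrarily: each `η k` is centred and independent of the
whole sequence `e` together with the noises already revealed. -/
theorem integral_sum_weighted_pow_le {e η : ℤ → Ω → ℝ} (he : ∀ i, Measurable (e i))
    (hηm : ∀ k, Measurable (η k)) (hη : iIndepFun η P)
    (hind : IndepFun (fun ω (k : ℤ) => e k ω) (fun ω (k : ℤ) => η k ω) P)
    (hηmom : ∀ k, HasMoments (η k) P) (hη0 : ∀ k, ∫ ω, η k ω ∂P = 0)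
    {φ : ℕ → (ℤ → ℝ) → ℝ} (hφ : ∀ k, Measurable (φ k))
    (hφmom : ∀ k, HasMoments (fun ω => φ k fun i => e i ω) P) (m : ℕ) {D H : ℝ} (hD : 0 ≤ D)
    (hH : 0 ≤ H) (hφD : ∀ k, ∫ ω, (φ k fun i => e i ω) ^ (2 * (m + 1)) ∂P ≤ D)
    (hηH : ∀ k, ∫ ω, η k ω ^ (2 * (m + 1)) ∂P ≤ H) (s : Finset ℕ) :
    ∫ ω, (∑ k ∈ s, (φ k fun i => e i ω) * η k ω) ^ (2 * (m + 1)) ∂P ≤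
      (3 * 4 ^ (m + 1) * (1 + D * H) * s.card) ^ (m + 1) := by
  induction s using Finset.induction_on with
  | empty => simp
  | insert k s hk ih =>
    set X : Ω → ℝ := fun ω => ∑ k ∈ s, (φ k fun i => e i ω) * η k ω with hX
    have hXm : HasMoments X P := .sum s fun k _ => (hφmom k).mul (hηmom k)
    have hYm : HasMoments (fun ω => (φ k fun i => e i ω) * η k ω) P := (hφmom k).mul (hηmom k)
    have hpast : IndepFun (fun ω => ((fun i => e i ω), fun j : s => η (j : ℕ) ω)) (η k) P := by
      refine IndepFun.prodMk_of_prodMk (by fun_prop) (by fun_prop) (hηm k) ?_ ?_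
      · exact hind.comp (φ := id)
          (ψ := fun y : ℤ → ℝ => ((fun j : s => y (j : ℕ)), y k)) measurable_id (by fun_prop)
      · have hinj : Function.Injective ((↑) : ℕ → ℤ) := Nat.cast_injective
        have h := (hη.precomp hinj).indepFun_finset s {k} (Finset.disjoint_singleton_right.2 hk)
          fun i => hηm i
        exact h.comp (φ := id) (ψ := fun z : (({k} : Finset ℕ) → ℝ) => z ⟨k, by simp⟩)
          measurable_id (measurable_pi_apply _)
    have h0 : ∫ ω, X ω ^ (2 * m + 1) * ((φ k fun i => e i ω) * η k ω) ∂P = 0 := by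
      have hi : IndepFun (fun ω => X ω ^ (2 * m + 1) * (φ k fun i => e i ω)) (η k) P := by
        have := hpast.comp (ψ := id) (φ := fun z : (ℤ → ℝ) × (s → ℝ) =>
          (∑ j : s, φ j z.1 * z.2 j) ^ (2 * m + 1) * φ k z.1) (by fun_prop) measurable_id
        refine this.congr (ae_of_all _ fun ω => ?_) (ae_of_all _ fun ω => rfl)
        simp only [hX, Function.comp]
        rw [← Finset.sum_coe_sort s]
      simp only [← mul_assoc]
      rw [hi.integral_fun_mul_eq_mul_integral ((hXm.pow _).mul (hφmom k)).aestronglyMeasurable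
        (hηmom k).aestronglyMeasurable, hη0, mul_zero]
    have hYb : ∫ ω, ((φ k fun i => e i ω) * η k ω) ^ (2 * (m + 1)) ∂P ≤
        (1 + D * H) ^ (m + 1) := by
      have hi : IndepFun (fun ω => (φ k fun i => e i ω) ^ (2 * (m + 1)))
          (fun ω => η k ω ^ (2 * (m + 1))) P :=
        hind.comp (φ := fun x => φ k x ^ (2 * (m + 1)))
          (ψ := fun y : ℤ → ℝ => y k ^ (2 * (m + 1))) (by fun_prop) (by fun_prop)
      simp only [mul_pow]
      rw [hi.integral_fun_mul_eq_mul_integral ((hφmom k).pow _).aestronglyMeasurable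
        ((hηmom k).pow _).aestronglyMeasurable]
      have hDH : 0 ≤ D * H := by positivity
      calc _ ≤ D * H := by
            refine mul_le_mul (hφD k) (hηH k) (integral_nonneg fun ω => ?_) hD
            exact (even_two_mul _).pow_nonneg _
        _ ≤ 1 + D * H := by linarith
        _ ≤ _ := le_self_pow₀ (by linarith) (by omega)
    have := integral_add_pow_le m hXm hYm h0 (by positivity) (by positivity) ih hYb
    have hXY : ∀ ω, ∑ j ∈ insert k s, (φ j fun i => e i ω) * η j ω =
        X ω + (φ k fun i => e i ω) * η k ω := fun ω => by rw [Finset.sum_insert hk, add_comm]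
    simp only [hXY]
    rw [Finset.card_insert_of_notMem hk]
    refine this.trans_eq ?_
    push_cast
    ring

/-! ### Recentring -/

theorem abs_pow_le_one_add_pow {p q : ℕ} (hpq : p ≤ 2 * q) (x : ℝ) : |x| ^ p ≤ 1 + x ^ (2 * q) := by
  rw [← (even_two_mul q).pow_abs]
  rcases le_total |x| 1 with h | h
  · linarith [pow_le_one₀ (n := p) (abs_nonneg x) h, pow_nonneg (abs_nonneg x) (2 * q)]
  · linarith [pow_le_pow_right₀ h hpq]

/-- The mean lies within `E |Y - c| ≤ 1 + B` of `c`, and convexity of the even power handles the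
shift. -/
theorem integrable_and_integral_abs_sub_integral_pow_le {Y : Ω → ℝ} {c B : ℝ} {p q : ℕ}
    (hq : 1 ≤ q) (hpq : p ≤ 2 * q) (hY : AEStronglyMeasurable Y P)
    (hint : Integrable (fun ω => (Y ω - c) ^ (2 * q)) P)
    (hB : ∫ ω, (Y ω - c) ^ (2 * q) ∂P ≤ B) :
    Integrable Y P ∧ Integrable (fun ω => |Y ω - ∫ ω', Y ω' ∂P| ^ p) P ∧
      ∫ ω, |Y ω - ∫ ω', Y ω' ∂P| ^ p ∂P ≤ 1 + 2 ^ (2 * q - 1) * (B + (1 + B) ^ (2 * q)) := by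
  have h1 : ∀ ω, |Y ω - c| ≤ 1 + (Y ω - c) ^ (2 * q) := fun ω => by
    simpa using abs_pow_le_one_add_pow (p := 1) (q := q) (by omega) (Y ω - c)
  have hbd : Integrable (fun ω => 1 + (Y ω - c) ^ (2 * q)) P := (integrable_const 1).add hint
  have hYc : Integrable (fun ω => Y ω - c) P :=
    hbd.mono' (hY.sub aestronglyMeasurable_const) (ae_of_all _ h1)
  have hYi : Integrable Y P := by
    refine (hYc.add (integrable_const c)).congr (ae_of_all _ fun ω => ?_)
    simp
  set μ := ∫ ω, Y ω ∂P
  have hμ : |c - μ| ≤ 1 + B := by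
    have e : μ - c = ∫ ω, (Y ω - c) ∂P := by
      rw [integral_sub hYi (integrable_const c)]; simp [μ]
    rw [abs_sub_comm, e]
    refine (abs_integral_le_integral_abs).trans ((integral_mono hYc.abs hbd h1).trans ?_)
    rw [integral_add (integrable_const 1) hint]
    simpa using hB
  have h2 : ∀ ω, |Y ω - μ| ^ p ≤
      1 + 2 ^ (2 * q - 1) * ((Y ω - c) ^ (2 * q) + (c - μ) ^ (2 * q)) := by
    intro ω
    refine (abs_pow_le_one_add_pow hpq _).trans ?_
    have := (even_two_mul q).add_pow_le (a := Y ω - c) (b := c - μ)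
    rw [sub_add_sub_cancel] at this
    linarith
  have hbd2 : Integrable (fun ω => (Y ω - c) ^ (2 * q) + (c - μ) ^ (2 * q)) P :=
    hint.add (integrable_const _)
  have hbd3 : Integrable
      (fun ω => 1 + 2 ^ (2 * q - 1) * ((Y ω - c) ^ (2 * q) + (c - μ) ^ (2 * q))) P :=
    (integrable_const 1).add (hbd2.const_mul _)
  have hp : Integrable (fun ω => |Y ω - μ| ^ p) P := by
    refine hbd3.mono' ?_ (ae_of_all _ fun ω => ?_)
    · exact (hY.sub (aestronglyMeasurable_const (b := μ))).norm.pow p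
    · rw [Real.norm_of_nonneg (by positivity)]
      exact h2 ω
  refine ⟨hYi, hp, (integral_mono hp hbd3 h2).trans ?_⟩
  rw [integral_add (integrable_const 1) (hbd2.const_mul _), integral_const_mul,
    integral_add hint (integrable_const _)]
  simp only [integral_const, probReal_univ, one_smul]
  have h3 : (c - μ) ^ (2 * q) ≤ (1 + B) ^ (2 * q) := by
    rw [← (even_two_mul q).pow_abs]
    exact pow_le_pow_left₀ (abs_nonneg _) hμ _
  gcongr

end

/-! ### The LMSD process -/

namespace IsLMSD

variable {Ω : Type*} [MeasurableSpace Ω] {P : Measure Ω} {d : ℝ}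
  {b : ℕ → ℝ} {e ε h τ : ℤ → Ω → ℝ}

theorem hasMoments_ε (hτ : IsLMSD P d b e ε h τ) (k : ℤ) : HasMoments (ε k) P :=
  .of_integrable_abs_pow (hτ.measurable_ε k).aestronglyMeasurable (hτ.moments_ε k)

theorem exists_subseq_tendsto_wickExp (hτ : IsLMSD P d b e ε h τ) (hd0 : 0 ≤ d)
    (hd : d < 1 / 2) (v : ℝ≥0) (n : ℕ) :
    ∃ u : ℕ → ℕ, ∀ k ∈ Finset.Icc 1 n, ∀ᵐ ω ∂P,
      Tendsto (fun i => wickExp v e (maCoeff b ((k : ℕ) : ℤ)) (Finset.Icc (-(u i : ℤ)) n) ω) atTop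
        (𝓝 (Real.exp (h k ω - v * (∑' j, b j ^ 2) / 2))) := by
  have hshift : ∀ k : ℕ, Tendsto (fun L => k + L + 1) atTop atTop := fun k =>
    tendsto_atTop_mono (fun L => show L ≤ k + L + 1 by omega) tendsto_id
  obtain ⟨u, hu, hus⟩ := exists_subseq_forall_tendsto_ae (P := P) (Finset.Icc 1 n)
    (f := fun (k : ℕ) L ω => ∑ j ∈ Finset.range (k + L + 1), b j * e (k - (j : ℤ)) ω)
    (g := fun (k : ℕ) => h k) fun k _ ε hε => (hτ.series_h k ε hε).comp (hshift k)
  refine ⟨u, fun k hk => ?_⟩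
  have hkn : k ≤ n := (Finset.mem_Icc.1 hk).2
  filter_upwards [hus k hk] with ω hω
  have hvar : Tendsto (fun i => ∑ j ∈ Finset.range (k + u i + 1), b j ^ 2) atTop
      (𝓝 (∑' j, b j ^ 2)) :=
    (hτ.coeff.summable_sq hd0 hd).hasSum.tendsto_sum_nat.comp
      ((hshift k).comp hu.tendsto_atTop)
  have hlim := (Real.continuous_exp.tendsto _).comp
    (hω.sub ((hvar.const_mul (v : ℝ)).div_const 2))
  refine hlim.congr fun i => ?_
  simp only [Function.comp, wickExp]
  rw [sum_maCoeff_Icc hkn (u i) (fun x i => x * e i ω - v * x ^ 2 / 2) (by simp),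
    Finset.sum_sub_distrib, ← Finset.sum_div, ← Finset.mul_sum]

variable [IsProbabilityMeasure P]

/-- Moment bound for the normalized durations built from the innovations `e i`, `i ∈ I`. -/
theorem exists_integral_truncated_pow_le (hτ : IsLMSD P d b e ε h τ) (hd0 : 0 ≤ d)
    (hd : d < 1 / 2) {v : ℝ≥0} (hv : ∀ k, P.map (e k) = gaussianReal 0 v) (m : ℕ) :
    ∃ B : ℝ, ∀ n : ℕ, 1 ≤ n → ∀ I : Finset ℤ,
      ∫ ω, (∑ k ∈ Finset.Icc 1 n, (wickExp v e (maCoeff b (k : ℤ)) I ω * ε k ω -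
        ∫ ω', ε 0 ω' ∂P)) ^ (2 * (m + 1)) ∂P ≤ B * ((n : ℝ) ^ (1 + 2 * d)) ^ (m + 1) := by
  set μ := ∫ ω, ε 0 ω ∂P with hμ
  set Q := ∑' j, b j ^ 2
  have hsq := hτ.coeff.summable_sq hd0 hd
  have hQ : ∀ (k : ℕ) (I : Finset ℤ), ∑ i ∈ I, maCoeff b (k : ℤ) i ^ 2 ≤ Q := fun k I =>
    sum_maCoeff_sq_le_tsum hsq k I
  have hR : ∀ (k : ℕ) (i : ℤ), |maCoeff b (k : ℤ) i| ≤ √Q := fun k i =>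
    Real.abs_le_sqrt (by simpa using hQ k {i})
  obtain ⟨C, hC0, hC⟩ := hτ.coeff.exists_sum_sq_maCoeff_le hd0 hd
  obtain ⟨A, hA0, hA⟩ := exists_integral_sum_wickExp_sub_one_pow_le hτ.measurable_e hτ.indep_e hv
    (√Q) Q m
  set η : ℤ → Ω → ℝ := fun k ω => ε k ω - μ with hη
  have hηmeas : ∀ k, Measurable (η k) := fun k => (hτ.measurable_ε k).sub_const μ
  have hηmom : ∀ k, HasMoments (η k) P := fun k => (hτ.hasMoments_ε k).sub_const μ
  have hηind : iIndepFun η P := hτ.indep_ε.comp (fun _ x => x - μ) fun _ => by fun_prop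
  have hηe : IndepFun (fun ω (k : ℤ) => e k ω) (fun ω (k : ℤ) => η k ω) P :=
    hτ.indep_e_ε.comp (φ := id) (ψ := fun (y : ℤ → ℝ) k => y k - μ) measurable_id (by fun_prop)
  have hη0 : ∀ k, ∫ ω, η k ω ∂P = 0 := by
    intro k
    rw [hη, integral_sub (hτ.hasMoments_ε k).integrable (integrable_const μ),
      (hτ.identDistrib_ε k).integral_eq, hμ]
    simp
  set H := ∫ ω, η 0 ω ^ (2 * (m + 1)) ∂P with hHdef
  have hH0 : 0 ≤ H := integral_nonneg fun ω => (even_two_mul _).pow_nonneg _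
  have hηH : ∀ k, ∫ ω, η k ω ^ (2 * (m + 1)) ∂P ≤ H := fun k =>
    ((hτ.identDistrib_ε k).comp (u := fun x => (x - μ) ^ (2 * (m + 1))) (by fun_prop)).integral_eq.le
  set D := Real.exp (v / 2 * ((2 * (m + 1) : ℕ) : ℝ) ^ 2 * Q)
  set A' := 3 * 4 ^ (m + 1) * (1 + D * H)
  have hM := fun (k : ℕ) I =>
    hasMoments_wickExp (P := P) hτ.measurable_e hv (maCoeff b (k : ℤ)) I
  refine ⟨2 ^ (2 * (m + 1) - 1) * (μ ^ (2 * (m + 1)) * (A * C) ^ (m + 1) + A' ^ (m + 1)),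
    fun n hn I => ?_⟩
  set K := Finset.Icc 1 n
  set N := (n : ℝ) ^ (1 + 2 * d)
  -- The noise part is only of order `n`; `d ≥ 0` lets the volatility bound dominate it.
  have hnN : (n : ℝ) ≤ N := by
    conv_lhs => rw [← Real.rpow_one n]
    exact Real.rpow_le_rpow_of_exponent_le (by exact_mod_cast hn) (by linarith)
  set S : Ω → ℝ := fun ω => ∑ k ∈ K, (wickExp v e (maCoeff b (k : ℤ)) I ω - 1)
  set T : Ω → ℝ := fun ω => ∑ k ∈ K, wickExp v e (maCoeff b (k : ℤ)) I ω * η k ω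
  have hS : HasMoments S P := .sum K fun k _ => (hM k I).sub_const 1
  have hT : HasMoments T P := .sum K fun k _ => (hM k I).mul (hηmom k)
  have hSb : ∫ ω, S ω ^ (2 * (m + 1)) ∂P ≤ (A * C * N) ^ (m + 1) := by
    refine (hA K (fun k => maCoeff b (k : ℤ)) hR hQ I).trans ?_
    rw [mul_assoc]
    gcongr
    exact hC n hn I
  have hTb : ∫ ω, T ω ^ (2 * (m + 1)) ∂P ≤ (A' * N) ^ (m + 1) := by
    have := integral_sum_weighted_pow_le hτ.measurable_e hηmeas hηind hηe hηmom hη0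
      (φ := fun k x => Real.exp (∑ i ∈ I, (maCoeff b (k : ℤ) i * x i -
        v * maCoeff b (k : ℤ) i ^ 2 / 2))) (fun k => by fun_prop) (fun k => hM k I) m
      (Real.exp_pos _).le hH0
      (fun k => integral_wickExp_pow_le hτ.measurable_e hτ.indep_e hv (hQ k I) (2 * (m + 1)))
      hηH K
    refine this.trans ?_
    rw [Nat.card_Icc, Nat.add_sub_cancel]
    gcongr
  have hdecomp : ∀ ω, ∑ k ∈ K, (wickExp v e (maCoeff b (k : ℤ)) I ω * ε k ω - μ) =
      μ * S ω + T ω := by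
    intro ω
    simp only [S, T]
    rw [Finset.mul_sum, ← Finset.sum_add_distrib]
    exact Finset.sum_congr rfl fun k _ => by rw [hη]; ring
  simp only [hdecomp]
  have hi1 := (hS.pow (2 * (m + 1))).integrable
  have hi2 := (hT.pow (2 * (m + 1))).integrable
  have hi3 : Integrable (fun ω => μ ^ (2 * (m + 1)) * S ω ^ (2 * (m + 1)) +
      T ω ^ (2 * (m + 1))) P := (hi1.const_mul _).add hi2
  have hpt : ∀ ω, (μ * S ω + T ω) ^ (2 * (m + 1)) ≤ 2 ^ (2 * (m + 1) - 1) *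
      (μ ^ (2 * (m + 1)) * S ω ^ (2 * (m + 1)) + T ω ^ (2 * (m + 1))) := fun ω => by
    simpa [mul_pow] using (even_two_mul (m + 1)).add_pow_le (a := μ * S ω) (b := T ω)
  refine (integral_mono (((hS.const_mul μ).add hT).pow _).integrable (hi3.const_mul _) hpt).trans ?_
  rw [integral_const_mul, integral_add (hi1.const_mul _) hi2, integral_const_mul]
  have hμ2 : 0 ≤ μ ^ (2 * (m + 1)) := (even_two_mul _).pow_nonneg _
  calc _ ≤ 2 ^ (2 * (m + 1) - 1) *
        (μ ^ (2 * (m + 1)) * (A * C * N) ^ (m + 1) + (A' * N) ^ (m + 1)) := by gcongr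
    _ = _ := by rw [mul_pow _ N, mul_pow _ N]; ring

/-- The centring constant may depend on `n`; the proof takes `κ n μ / n ^ (1/2 + d)` without having
to identify it as the mean. -/
theorem exists_integral_sub_const_pow_le (hτ : IsLMSD P d b e ε h τ) (hd0 : 0 ≤ d)
    (hd : d < 1 / 2) (m : ℕ) :
    ∃ B : ℝ, ∀ n : ℕ, 1 ≤ n → AEStronglyMeasurable (normalizedSum d τ n) P ∧ ∃ c : ℝ,
      Integrable (fun ω => (normalizedSum d τ n ω - c) ^ (2 * (m + 1))) P ∧
      ∫ ω, (normalizedSum d τ n ω - c) ^ (2 * (m + 1)) ∂P ≤ B := by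
  obtain ⟨v, hv⟩ := hτ.gaussian_e
  obtain ⟨B, hB⟩ := hτ.exists_integral_truncated_pow_le hd0 hd hv m
  set μ := ∫ ω, ε 0 ω ∂P
  set κ := Real.exp (v * (∑' j, b j ^ 2) / 2) with hκ
  refine ⟨(κ ^ 2) ^ (m + 1) * B, fun n hn => ?_⟩
  obtain ⟨u, hu⟩ := hτ.exists_subseq_tendsto_wickExp hd0 hd v n
  have hn0 : (0 : ℝ) < n := by exact_mod_cast hn
  set W : ℕ → Ω → ℝ := fun i ω => ∑ k ∈ Finset.Icc 1 n,
    (wickExp v e (maCoeff b (k : ℤ)) (Finset.Icc (-(u i : ℤ)) n) ω * ε k ω - μ)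
  set W' : Ω → ℝ := fun ω => ∑ k ∈ Finset.Icc 1 n,
    (Real.exp (h k ω - v * (∑' j, b j ^ 2) / 2) * ε k ω - μ)
  have hW : ∀ i, HasMoments (W i) P := fun i => .sum _ fun k _ =>
    ((hasMoments_wickExp hτ.measurable_e hv _ _).mul (hτ.hasMoments_ε k)).sub_const μ
  have hlim : ∀ᵐ ω ∂P, Tendsto (fun i => W i ω) atTop (𝓝 (W' ω)) := by
    filter_upwards [(Finset.eventually_all _).2 hu] with ω hω
    exact tendsto_finsetSum _ fun k hk => ((hω k hk).mul_const _).sub_const μ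
  have hW'm : AEStronglyMeasurable W' P :=
    aestronglyMeasurable_of_tendsto_ae atTop (fun i => (hW i).aestronglyMeasurable) hlim
  obtain ⟨hint, hle⟩ := integrable_and_integral_le_of_tendsto_ae
    (fun i => ((hW i).pow (2 * (m + 1))).integrable)
    (fun i ω => (even_two_mul _).pow_nonneg _) (fun i => hB n hn _)
    (hlim.mono fun ω hω => hω.pow (2 * (m + 1)))
  set a := κ / (n : ℝ) ^ (1 / 2 + d) with ha
  have hY : ∀ ω, normalizedSum d τ n ω = a * W' ω + a * (n * μ) := by
    intro ω
    have hsum : W' ω = κ⁻¹ * ∑ k ∈ Finset.Icc 1 n, τ k ω - n * μ := by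
      simp only [W']
      rw [Finset.sum_sub_distrib, Finset.mul_sum]
      congr 1
      · refine Finset.sum_congr rfl fun k _ => ?_
        rw [hτ.duration_eq, Real.exp_sub, ← hκ]
        ring
      · simp
    have hκ0 : κ ≠ 0 := (Real.exp_pos _).ne'
    rw [hsum, normalizedSum, ha]
    field_simp
    ring
  refine ⟨?_, a * (n * μ), ?_⟩
  · exact ((hW'm.const_mul a).add aestronglyMeasurable_const).congr (ae_of_all _ fun ω => (hY ω).symm)
  · simp only [hY, add_sub_cancel_right, mul_pow]
    refine ⟨hint.const_mul _, ?_⟩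
    rw [integral_const_mul]
    have ha2 : a ^ 2 * (n : ℝ) ^ (1 + 2 * d) = κ ^ 2 := by
      have : (n : ℝ) ^ (1 + 2 * d) = ((n : ℝ) ^ (1 / 2 + d)) ^ 2 := by
        rw [← Real.rpow_natCast, ← Real.rpow_mul hn0.le]; congr 1; push_cast; ring
      rw [ha, this, div_pow, div_mul_cancel₀ _ (by positivity)]
    calc a ^ (2 * (m + 1)) * ∫ ω, W' ω ^ (2 * (m + 1)) ∂P
        ≤ a ^ (2 * (m + 1)) * (B * ((n : ℝ) ^ (1 + 2 * d)) ^ (m + 1)) :=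
          mul_le_mul_of_nonneg_left hle ((even_two_mul _).pow_nonneg _)
      _ = (a ^ 2 * (n : ℝ) ^ (1 + 2 * d)) ^ (m + 1) * B := by rw [pow_mul, mul_pow]; ring
      _ = _ := by rw [ha2]

end IsLMSD

theorem lemma1 {Ω : Type*} [MeasurableSpace Ω] (P : Measure Ω) [IsProbabilityMeasure P]
    (d : ℝ) (hd0 : 0 ≤ d) (hd : d < 1 / 2) (b : ℕ → ℝ) (e ε h τ : ℤ → Ω → ℝ)
    (hτ : IsLMSD P d b e ε h τ) (p : ℕ) (hp : 2 ≤ p) :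
    ∃ M : ℝ, ∀ n : ℕ, 1 ≤ n →
      Integrable (normalizedSum d τ n) P ∧
      Integrable (fun ω => |normalizedSum d τ n ω - ∫ ω', normalizedSum d τ n ω' ∂P| ^ p) P ∧
      ∫ ω, |normalizedSum d τ n ω - ∫ ω', normalizedSum d τ n ω' ∂P| ^ p ∂P ≤ M := by
  -- Any even exponent at least `p` would do; `2 * (p + 1)` needs no parity distinction.
  obtain ⟨B, hB⟩ := hτ.exists_integral_sub_const_pow_le hd0 hd p
  refine ⟨1 + 2 ^ (2 * (p + 1) - 1) * (B + (1 + B) ^ (2 * (p + 1))), fun n hn => ?_⟩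
  obtain ⟨hm, c, hint, hle⟩ := hB n hn
  exact integrable_and_integral_abs_sub_integral_pow_le (by omega) (by omega) hm hint hle
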